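/- Let $k$ be an algebraically closed field of characteristic $p>0$. Let $d,e_1,e_2,e_3$ be positive integers with $2d-2=\sum_{i=1}^3(e_i-1)$, with each $e_i$ prime to $p$ and $e_i\le d$ for all $i$, and let $Q_1,Q_2,Q_3$ be distinct points of $\mathbb P^1_k$. Call $(e_1,e_2,e_3)$ numerically $p$-admissible if for every integer $m>0$ and every subset $S\subseteq\{1,2,3\}$ such that (i) $p^m\le d$, (ii) $e_i>p^m$ for all $i\in S$, (iii) $\sum_{i\in S}\lfloor e_i/p^m\rfloor+\sum_{i\notin S}\lceil e_i/p^m\rceil$ is odd, one has $$\sum_{i\in S}\bigl(e_i-p^m\lfloor e_i/p^m\rfloor\bigr)+\sum_{i\notin S}\bigl(p^m\lceil e_i/p^m\rceil-e_i\bigr)\ \ge\ p^m.$$ Then $(e_1,e_2,e_3)$ is numerically $p$-admissible if and only if there exists a separable morphism $f:\mathbb P^1_k\to\mathbb P^1_k$ of degree $d$ such that, for each $i$, the fibre over $Q_i$ contains a point at which $f$ has ramification index $e_i$, and $f$ is unramified at all other points of that fibre. Moreover such a cover is necessarily unique up to automorphism of the source: if $f$ and $f'$ are two such morphisms, then $f'=f\circ\varphi$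 for some automorphism $\varphi$ of $\mathbb P^1_k$. -/

import Mathlib

open scoped IntermediateField

noncomputable section

namespace ThreePointCover

/-- The closed points of the projective line over `k`, in homogeneous coordinates `[x₀ : x₁]`. -/
abbrev P1 (k : Type*) [Field k] : Type _ := Projectivization k (Fin 2 → k)

/-- A morphism `ℙ¹ → ℙ¹` over an algebraically closed field `k` (constant morphisms included):
`[x₀ : x₁] ↦ [F 0 (x₀, x₁) : F 1 (x₀, x₁)]`, where `F 0` and `F 1` are binary forms of the same
degree without common zero. The pair `F` is determined by the morphism up to a nonzero scalar;
morphisms are compared through the maps on closed points, which determine them. -/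
structure Mor (k : Type*) [Field k] [IsAlgClosed k] where
  formDegree : ℕ
  F : Fin 2 → MvPolynomial (Fin 2) k
  isHomogeneous : ∀ j, (F j).IsHomogeneous formDegree
  no_common_zero : ∀ v : Fin 2 → k, v ≠ 0 → (fun j => MvPolynomial.eval v (F j)) ≠ 0

variable {k : Type*} [Field k] [IsAlgClosed k]

/-- The map on closed points given by a morphism. -/
def Mor.map (f : Mor k) (P : P1 k) : P1 k :=
  Projectivization.mk k (fun j => MvPolynomial.eval P.rep (f.F j))
    (f.no_common_zero P.rep P.rep_nonzero)

/-- The map on closed points may be computed with any homogeneous coordinates. -/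
theorem Mor.map_mk (f : Mor k) (v : Fin 2 → k) (hv : v ≠ 0) :
    f.map (Projectivization.mk k v hv) =
      Projectivization.mk k (fun j => MvPolynomial.eval v (f.F j)) (f.no_common_zero v hv) := by
  obtain ⟨a, ha⟩ := Projectivization.exists_smul_eq_mk_rep k v hv
  unfold Mor.map
  rw [Projectivization.mk_eq_mk_iff']
  refine ⟨(a : k) ^ f.formDegree, ?_⟩
  funext j
  rw [← ha]
  have key : MvPolynomial.eval ((a : k) • v) (f.F j) =
      (a : k) ^ f.formDegree * MvPolynomial.eval v (f.F j) := by
    simp only [MvPolynomial.eval_eq', Finset.mul_sum]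
    refine Finset.sum_congr rfl fun m hm => ?_
    have hdeg := (f.isHomogeneous j) (MvPolynomial.mem_support_iff.mp hm)
    simp only [Finsupp.weight_apply, Finsupp.sum_fintype, Pi.one_apply, smul_eq_mul, mul_one,
      implies_true, Fin.sum_univ_two] at hdeg
    simp only [Fin.prod_univ_two, Pi.smul_apply, smul_eq_mul, mul_pow, ← hdeg, pow_add]
    ring
  exact key.symm

/-- The pullback to the source, as an element of its function field `k(x)`, `x = x₀ / x₁`,
of the coordinate function `x` of the target. -/
def Mor.coord (f : Mor k) : RatFunc k :=
  MvPolynomial.aeval ![RatFunc.X, 1] (f.F 0) / MvPolynomial.aeval ![RatFunc.X, 1] (f.F 1)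

/-- The image of the function field of the target in the function field `k(x)` of the source,
i.e. the subfield `k(f)` of `k(x)`; for constant `f` it is `k`. -/
def Mor.pullbackField (f : Mor k) : IntermediateField k (RatFunc k) := k⟮f.coord⟯

/-- The degree of a nonconstant morphism: the degree of the extension of function fields
`k(x) / k(f)`. For a constant morphism this extension is infinite, and the value is `0`. -/
def Mor.degree (f : Mor k) : ℕ := Module.finrank f.pullbackField (RatFunc k)

/-- `f` is (nonconstant and) separable: `k(x)` is a separable algebraic extension of `k(f)`. -/
def Mor.IsSeparable (f : Mor k) : Prop := Algebra.IsSeparable f.pullbackField (RatFunc k)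

/-- A linear form on `ℙ¹` whose only zero, a simple one, is `P`. -/
def linForm (P : P1 k) : MvPolynomial (Fin 2) k :=
  MvPolynomial.C (P.rep 1) * MvPolynomial.X 0 - MvPolynomial.C (P.rep 0) * MvPolynomial.X 1

/-- The ramification index of `f` at `P`: the order of vanishing at `P` of the pullback under `f`
of a linear form on the target that vanishes (to order one) exactly at `f P`. It is `⊤` if and
only if `f` is constant. -/
def Mor.ramificationIndex (f : Mor k) (P : P1 k) : ℕ∞ :=
  emultiplicity (linForm P) (MvPolynomial.bind₁ f.F (linForm (f.map P)))

/-- `φ` is an automorphism of `ℙ¹`: it has an inverse morphism. -/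
def Mor.IsAutomorphism (φ : Mor k) : Prop :=
  ∃ ψ : Mor k, (∀ P, ψ.map (φ.map P) = P) ∧ ∀ P, φ.map (ψ.map P) = P

/-- `f` is a separable cover `ℙ¹ → ℙ¹` of degree `d` with, over each `Q i`, a single ramification
point of index `e i`: the fibre over `Q i` has a point of ramification index `e i`, and `f` is
unramified at all other points of that fibre. -/
def IsCoverWith (d : ℕ) (e : Fin 3 → ℕ) (Q : Fin 3 → P1 k) (f : Mor k) : Prop :=
  f.degree = d ∧ f.IsSeparable ∧
    ∀ i, ∃ P, f.map P = Q i ∧ f.ramificationIndex P = (e i : ℕ∞) ∧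
      ∀ P', f.map P' = Q i → P' ≠ P → f.ramificationIndex P' = 1

/-- `⌈e / p ^ m⌉` -/
def barUp (p m e : ℕ) : ℤ := ⌈(e : ℚ) / (p : ℚ) ^ m⌉

/-- `⌊e / p ^ m⌋` -/
def barDown (p m e : ℕ) : ℤ := ⌊(e : ℚ) / (p : ℚ) ^ m⌋

/-- `p ^ m * ⌈e / p ^ m⌉ - e` -/
def diffUp (p m e : ℕ) : ℤ := (p : ℤ) ^ m * barUp p m e - e

/-- `e - p ^ m * ⌊e / p ^ m⌋` -/
def diffDown (p m e : ℕ) : ℤ := e - (p : ℤ) ^ m * barDown p m e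

/-- Numerical `p`-admissibility of a triple of positive integers prime to `p`, with odd sum and
satisfying the triangle inequality. The integer `d` is the one with `2d - 2 = ∑ (e i - 1)`. -/
def NumericallyAdmissible (p : ℕ) (e : Fin 3 → ℕ) : Prop :=
  ∀ (d m : ℕ) (S : Finset (Fin 3)),
    2 * (d : ℤ) - 2 = ∑ i, ((e i : ℤ) - 1) →
    0 < m →
    p ^ m ≤ d →
    (∀ i ∈ S, p ^ m < e i) →
    Odd (∑ i ∈ S, barDown p m (e i) + ∑ i ∈ Sᶜ, barUp p m (e i)) →
    (p : ℤ) ^ m ≤ ∑ i ∈ S, diffDown p m (e i) + ∑ i ∈ Sᶜ, diffUp p m (e i)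

end ThreePointCover

end

/-! The degree relation says that `∑ e i = 2d + 1`. A cover amounts to a pencil `F` of binary forms
of degree `d`, separable and without base points, such that at points `P i` the equation of the
fibre over `Q i` is divisible by the `e i`-th power of the linear form of `P i`. Rigidity
(`cross_mul_eq_of_dvd`): if `F` and `G` have degree at most `d` and satisfy these divisibilities at
the same points, then `F 0 * G 1 - F 1 * G 0` has degree at most `2d` and a divisor of degree `2d +
1`, so it vanishes, and `F`, `G` give the same function. With 3-transitivity on the source, this is
uniqueness. A nonzero pencil with these divisibilities always exists: there are `2d + 2`
coefficients and `2d + 1` conditions (`exists_pencil`). Write it as `g` times a pencil `(A, B)` of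
degree `D` evaluated at `x ^ q`, with `q = p ^ m` and nonzero Wronskian. Riemann-Hurwitz for `(A,
B)`, compared with `2d + 1`, leaves two cases: either `m = 0`, `g` is constant and `D = d`, so the
pencil is a cover; or `m > 0` and the ramification of `(A, B)` gives an obstruction `(ε, D)` in the
sense of `numericallyAdmissible_iff`. Conversely, an obstruction yields a pencil of degree `D`. Its
Frobenius pullback, multiplied by base points, has degree at most `d` and the divisibilities of any
cover `f`. By rigidity `f` would be a function of `x ^ q`, contradicting separability. -/

noncomputable section

namespace ThreePointCover

/-! ### Binary forms: rigidity and existence of pencils -/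

section Forms

open MvPolynomial

variable {k : Type*} [Field k]

/-- The binary linear form `v₁ x₀ - v₀ x₁`, which vanishes on the line spanned by `v`. -/
def linearForm (v : Fin 2 → k) : MvPolynomial (Fin 2) k :=
  C (v 1) * X 0 - C (v 0) * X 1

/-- The determinant of two vectors of the plane. -/
def det₂ (u v : Fin 2 → k) : k := u 0 * v 1 - u 1 * v 0

theorem linearForm_isHomogeneous (v : Fin 2 → k) : (linearForm v).IsHomogeneous 1 :=
  ((isHomogeneous_X k 0).C_mul _).sub ((isHomogeneous_X k 1).C_mul _)

theorem linearForm_smul (c : k) (v : Fin 2 → k) :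
    linearForm (c • v) = C c * linearForm v := by
  simp [linearForm]; ring

theorem eval_linearForm (u v : Fin 2 → k) : eval u (linearForm v) = det₂ u v := by
  simp [linearForm, det₂]; ring

theorem bind₁_linearForm (F : Fin 2 → MvPolynomial (Fin 2) k) (v : Fin 2 → k) :
    bind₁ F (linearForm v) = C (v 1) * F 0 - C (v 0) * F 1 := by
  simp [linearForm]

theorem vec_ne_zero_iff (v : Fin 2 → k) : v ≠ 0 ↔ v 0 ≠ 0 ∨ v 1 ≠ 0 := by
  rw [Ne, funext_iff, Fin.forall_fin_two]
  simp only [Pi.zero_apply]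
  tauto

theorem coeff_linearForm_zero (v : Fin 2 → k) :
    coeff (Finsupp.single 0 1) (linearForm v) = v 1 := by
  simp [linearForm, coeff_C_mul, coeff_X, Finsupp.single_left_inj]

theorem coeff_linearForm_one (v : Fin 2 → k) :
    coeff (Finsupp.single 1 1) (linearForm v) = -v 0 := by
  simp [linearForm, coeff_C_mul, coeff_X, Finsupp.single_left_inj]

theorem linearForm_ne_zero {v : Fin 2 → k} (hv : v ≠ 0) : linearForm v ≠ 0 := by
  intro h
  rcases (vec_ne_zero_iff v).1 hv with h0 | h1
  · apply h0
    simpa [h] using (coeff_linearForm_one v).symm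
  · apply h1
    simpa [h] using (coeff_linearForm_zero v).symm

theorem totalDegree_linearForm {v : Fin 2 → k} (hv : v ≠ 0) : (linearForm v).totalDegree = 1 :=
  (linearForm_isHomogeneous v).totalDegree (linearForm_ne_zero hv)

theorem irreducible_linearForm {v : Fin 2 → k} (hv : v ≠ 0) : Irreducible (linearForm v) := by
  refine irreducible_of_totalDegree_eq_one (totalDegree_linearForm hv) fun x hx => ?_
  rw [isUnit_iff_ne_zero]
  rintro rfl
  rcases (vec_ne_zero_iff v).1 hv with h0 | h1
  · have := hx (Finsupp.single 1 1)
    rw [coeff_linearForm_one, zero_dvd_iff, neg_eq_zero] at this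
    exact h0 this
  · have := hx (Finsupp.single 0 1)
    rw [coeff_linearForm_zero, zero_dvd_iff] at this
    exact h1 this

theorem isRelPrime_linearForm {u v : Fin 2 → k} (hu : u ≠ 0) (huv : det₂ u v ≠ 0) :
    IsRelPrime (linearForm u) (linearForm v) := by
  rw [(irreducible_linearForm hu).isRelPrime_iff_not_dvd]
  rintro ⟨r, hr⟩
  have := congrArg (eval u) hr
  rw [map_mul, eval_linearForm, eval_linearForm, show det₂ u u = 0 by simp [det₂]; ring,
    zero_mul] at this
  exact huv this

/-- Two pencils of forms of degree at most `d`, having sufficiently high vanishing along the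
same data, define the same rational function. -/
theorem cross_mul_eq_of_dvd {ι : Type*} [Fintype ι] {d : ℕ} {e : ι → ℕ} (hde : 2 * d < ∑ i, e i)
    {u w : ι → Fin 2 → k} (hu : ∀ i, u i ≠ 0) (hw : ∀ i, w i ≠ 0)
    (huu : ∀ i j, i ≠ j → det₂ (u i) (u j) ≠ 0)
    {F G : Fin 2 → MvPolynomial (Fin 2) k}
    (hF : ∀ j, (F j).totalDegree ≤ d) (hG : ∀ j, (G j).totalDegree ≤ d)
    (hFd : ∀ i, linearForm (u i) ^ e i ∣ bind₁ F (linearForm (w i)))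
    (hGd : ∀ i, linearForm (u i) ^ e i ∣ bind₁ G (linearForm (w i))) :
    F 0 * G 1 = F 1 * G 0 := by
  by_contra hne
  have hne' : F 0 * G 1 - F 1 * G 0 ≠ 0 := sub_ne_zero.2 hne
  -- Modulo this power, `F` and `G` are both proportional to `w i`, so their determinant is zero; a
  -- nonzero coordinate of `w i` allows the elimination.
  have hdvd (i) : linearForm (u i) ^ e i ∣ F 0 * G 1 - F 1 * G 0 := by
    have h1 := hFd i
    have h2 := hGd i
    rw [bind₁_linearForm] at h1 h2
    rcases (vec_ne_zero_iff _).1 (hw i) with h | h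
    · have := (h1.mul_right (G 0)).sub (h2.mul_right (F 0))
      have e1 : (C (w i 1) * F 0 - C (w i 0) * F 1) * G 0 -
          (C (w i 1) * G 0 - C (w i 0) * G 1) * F 0 =
          C (w i 0) * (F 0 * G 1 - F 1 * G 0) := by ring
      rw [e1] at this
      exact ((h.isUnit.map C).dvd_mul_left).1 this
    · have := (h1.mul_right (G 1)).sub (h2.mul_right (F 1))
      have e1 : (C (w i 1) * F 0 - C (w i 0) * F 1) * G 1 -
          (C (w i 1) * G 0 - C (w i 0) * G 1) * F 1 =
          C (w i 1) * (F 0 * G 1 - F 1 * G 0) := by ring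
      rw [e1] at this
      exact ((h.isUnit.map C).dvd_mul_left).1 this
  have hprod : ∏ i, linearForm (u i) ^ e i ∣ F 0 * G 1 - F 1 * G 0 :=
    Finset.prod_dvd_of_isRelPrime
      (fun i _ j _ hij => (isRelPrime_linearForm (hu i) (huu i j hij)).pow) fun i _ => hdvd i
  obtain ⟨r, hr⟩ := hprod
  have hp0 : ∏ i, linearForm (u i) ^ e i ≠ 0 :=
    Finset.prod_ne_zero_iff.2 fun i _ => pow_ne_zero _ (linearForm_ne_zero (hu i))
  have hr0 : r ≠ 0 := by rintro rfl; exact hne' (by simpa using hr)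
  have hdeg : (∏ i, linearForm (u i) ^ e i).totalDegree = ∑ i, e i := by
    refine IsHomogeneous.totalDegree ?_ hp0
    refine IsHomogeneous.prod _ _ _ fun i _ => ?_
    simpa using (linearForm_isHomogeneous (u i)).pow (e i)
  have h1 : (F 0 * G 1 - F 1 * G 0).totalDegree ≤ 2 * d := by
    refine (totalDegree_sub _ _).trans (max_le ?_ ?_) <;>
    · refine (totalDegree_mul _ _).trans ?_
      have := hF 0; have := hF 1; have := hG 0; have := hG 1
      omega
  rw [hr, totalDegree_mul_of_isDomain hp0 hr0, hdeg] at h1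
  omega

/-- Dehomogenization with respect to the second variable. -/
def dehom : MvPolynomial (Fin 2) k →ₐ[k] Polynomial k := aeval ![Polynomial.X, 1]

@[simp] theorem dehom_C (c : k) : dehom (C c : MvPolynomial (Fin 2) k) = Polynomial.C c := by
  simp [dehom]

@[simp] theorem dehom_X_zero : dehom (X 0 : MvPolynomial (Fin 2) k) = Polynomial.X := by
  simp [dehom]

@[simp] theorem dehom_X_one : dehom (X 1 : MvPolynomial (Fin 2) k) = 1 := by
  simp [dehom]

theorem dehom_linearForm (v : Fin 2 → k) :
    dehom (linearForm v) = Polynomial.C (v 1) * Polynomial.X - Polynomial.C (v 0) := by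
  simp [linearForm]

theorem dehom_linearForm_eq_C_mul {v : Fin 2 → k} (hv : v 1 ≠ 0) :
    dehom (linearForm v) =
      Polynomial.C (v 1) * (Polynomial.X - Polynomial.C (v 0 / v 1)) := by
  rw [dehom_linearForm, mul_sub, ← Polynomial.C_mul, mul_div_cancel₀ _ hv]

theorem homogenize_dehom {n : ℕ} {Φ : MvPolynomial (Fin 2) k} (h : Φ.IsHomogeneous n) :
    (dehom Φ).homogenize n = Φ :=
  Polynomial.homogenize_eq_of_isHomogeneous h rfl

theorem dehom_homogenize {n : ℕ} {g : Polynomial k} (h : g.natDegree ≤ n) :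
    dehom (g.homogenize n) = g :=
  Polynomial.aeval_homogenize_X_one g h

theorem eval_eq_eval_dehom (x : k) (Φ : MvPolynomial (Fin 2) k) :
    eval ![x, 1] Φ = (dehom Φ).eval x := by
  induction Φ using MvPolynomial.induction_on with
  | C a => simp
  | add p q hp hq => simp [hp, hq]
  | mul_X p i hp => fin_cases i <;> simp [hp]

theorem natDegree_dehom_le_totalDegree (Φ : MvPolynomial (Fin 2) k) :
    (dehom Φ).natDegree ≤ Φ.totalDegree := by
  conv_lhs => rw [Φ.as_sum, map_sum]
  refine Polynomial.natDegree_sum_le_of_forall_le _ _ fun m hm => ?_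
  have h1 := le_totalDegree hm
  rw [Finsupp.sum_fintype _ _ (by simp), Fin.sum_univ_two] at h1
  rw [dehom, aeval_monomial, Finsupp.prod_fintype _ _ (by simp), Fin.prod_univ_two]
  refine (Polynomial.natDegree_C_mul_le _ _).trans ?_
  simp
  omega

theorem natDegree_dehom_le {n : ℕ} {Φ : MvPolynomial (Fin 2) k} (h : Φ.IsHomogeneous n) :
    (dehom Φ).natDegree ≤ n :=
  (natDegree_dehom_le_totalDegree Φ).trans h.totalDegree_le

theorem dehom_injOn {n : ℕ} {Φ Ψ : MvPolynomial (Fin 2) k} (h : Φ.IsHomogeneous n)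
    (h' : Ψ.IsHomogeneous n) (hd : dehom Φ = dehom Ψ) : Φ = Ψ := by
  rw [← homogenize_dehom h, hd, homogenize_dehom h']

theorem eval_infty {n : ℕ} {Φ : MvPolynomial (Fin 2) k} (h : Φ.IsHomogeneous n) :
    eval ![1, 0] Φ = (dehom Φ).coeff n := by
  conv_lhs => rw [← homogenize_dehom h]
  rw [Polynomial.homogenize, map_sum, Finset.sum_eq_single (n, 0)]
  · simp [eval_monomial, Finsupp.update_eq_add_single, Finsupp.prod_fintype]
  · rintro ⟨a, b⟩ hab hne
    have hb : b ≠ 0 := by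
      rintro rfl
      simp at hab
      exact hne (by simp [hab])
    simp [eval_monomial, Finsupp.prod_fintype, hb]
  · simp

theorem linearForm_pow_dvd_homogenize {v : Fin 2 → k} (hv : v 1 ≠ 0) {n e : ℕ}
    {g : Polynomial k} (hg : g.natDegree ≤ n)
    (h : (Polynomial.X - Polynomial.C (v 0 / v 1)) ^ e ∣ g) :
    linearForm v ^ e ∣ g.homogenize n := by
  obtain ⟨r, rfl⟩ := h
  by_cases hr : r = 0
  · simp [hr]
  have hdeg := Polynomial.natDegree_mul
    (pow_ne_zero e (Polynomial.X_sub_C_ne_zero (v 0 / v 1))) hr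
  rw [Polynomial.natDegree_pow, Polynomial.natDegree_X_sub_C, mul_one] at hdeg
  have hn : n = e + (n - e) := by omega
  rw [hn, Polynomial.homogenize_mul _ _ (by simp) (by omega)]
  refine Dvd.dvd.mul_right ?_ _
  have : linearForm v ^ e = C (v 1 ^ e) *
      ((Polynomial.X - Polynomial.C (v 0 / v 1)) ^ e).homogenize e := by
    refine dehom_injOn (n := e) ?_ ((Polynomial.isHomogeneous_homogenize _).C_mul _) ?_
    · simpa using (linearForm_isHomogeneous v).pow e
    · rw [map_mul, dehom_homogenize (by simp), map_pow, dehom_linearForm_eq_C_mul hv, mul_pow]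
      simp
  rw [this]
  exact (((hv.isUnit.pow e).map C).mul_left_dvd).2 dvd_rfl

theorem linearForm_pow_dvd_homogenize_infty {v : Fin 2 → k} (hv : v 1 = 0) (hv0 : v 0 ≠ 0)
    {n e : ℕ} {g : Polynomial k} (hg : g.natDegree + e ≤ n) :
    linearForm v ^ e ∣ g.homogenize n := by
  have hn : n = (n - e) + e := by omega
  rw [← mul_one g, hn, Polynomial.homogenize_mul _ _ (by omega) (by simp),
    Polynomial.homogenize_one]
  refine Dvd.dvd.mul_left ?_ _
  have : linearForm v = C (-v 0) * X 1 := by simp [linearForm, hv]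
  rw [this, mul_pow]
  exact ((((neg_ne_zero.2 hv0).isUnit.map C).pow e).mul_left_dvd).2 dvd_rfl

/-- Divisibility of a form by a power of a linear form imposes that many linear conditions. -/
theorem exists_linearMap_dvd_homogenize {v : Fin 2 → k} (hv : v ≠ 0) (n e : ℕ) :
    ∃ T : Polynomial k →ₗ[k] (Fin e → k), ∀ g : Polynomial k, g.natDegree ≤ n → T g = 0 →
      linearForm v ^ e ∣ g.homogenize n := by
  -- At infinity the conditions are on the top `e` coefficients, elsewhere on the first `e` Taylor
  -- coefficients.
  by_cases h1 : v 1 = 0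
  · have h0 : v 0 ≠ 0 := ((vec_ne_zero_iff v).1 hv).resolve_right (not_not.2 h1)
    refine ⟨LinearMap.pi fun j => if (j : ℕ) ≤ n then Polynomial.lcoeff k (n - j) else 0,
      fun g hg hT => ?_⟩
    by_cases hg0 : g = 0
    · simp [hg0]
    refine linearForm_pow_dvd_homogenize_infty h1 h0 ?_
    by_contra hlt
    have := congrFun hT ⟨n - g.natDegree, by omega⟩
    simp [Nat.sub_sub_self hg, hg0] at this
  · refine ⟨LinearMap.pi fun j => Polynomial.lcoeff k j ∘ₗ Polynomial.taylor (v 0 / v 1),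
      fun g hg hT => ?_⟩
    refine linearForm_pow_dvd_homogenize h1 hg ?_
    have h : Polynomial.X ^ e ∣ Polynomial.taylor (v 0 / v 1) g := by
      rw [Polynomial.X_pow_dvd_iff]
      intro j hj
      exact congrFun hT ⟨j, hj⟩
    obtain ⟨r, hr⟩ := h
    refine ⟨Polynomial.taylor (-(v 0 / v 1)) r, ?_⟩
    have := congrArg (Polynomial.taylor (-(v 0 / v 1))) hr
    rw [Polynomial.taylor_taylor] at this
    simpa [Polynomial.taylor_mul, sub_eq_add_neg] using this

/-- A pencil of forms with prescribed vanishing exists as soon as the number of conditions is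
smaller than the number of coefficients. -/
theorem exists_pencil {ι : Type*} [Fintype ι] {d : ℕ} {e : ι → ℕ} (hde : ∑ i, e i < 2 * d + 2)
    {u : ι → Fin 2 → k} (hu : ∀ i, u i ≠ 0) (w : ι → Fin 2 → k) :
    ∃ G : Fin 2 → MvPolynomial (Fin 2) k, G ≠ 0 ∧ (∀ j, (G j).IsHomogeneous d) ∧
      ∀ i, linearForm (u i) ^ e i ∣ bind₁ G (linearForm (w i)) := by
  choose T hT using fun i => exists_linearMap_dvd_homogenize (hu i) d (e i)
  let V := Polynomial.degreeLT k (d + 1)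
  let L : (V × V) →ₗ[k] ((i : ι) → Fin (e i) → k) := LinearMap.pi fun i =>
    T i ∘ₗ (w i 1 • (V.subtype ∘ₗ LinearMap.fst k V V) - w i 0 • (V.subtype ∘ₗ LinearMap.snd k V V))
  have : Module.finrank k ((i : ι) → Fin (e i) → k) < Module.finrank k (V × V) := by
    rw [Module.finrank_prod, Module.finrank_pi_fintype]
    simp only [Module.finrank_fintype_fun_eq_card, Fintype.card_fin]
    rw [(Polynomial.degreeLTEquiv k (d + 1)).finrank_eq]
    simp only [Module.finrank_fintype_fun_eq_card, Fintype.card_fin]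
    omega
  have : FiniteDimensional k V := (Polynomial.degreeLTEquiv k (d + 1)).symm.finiteDimensional
  obtain ⟨x, hx, hx0⟩ := (LinearMap.ker L).ne_bot_iff.1 (LinearMap.ker_ne_bot_of_finrank_lt ‹_›)
  have hV (y : V) : (y : Polynomial k).natDegree ≤ d := by
    have := Polynomial.mem_degreeLT.1 y.2
    exact Polynomial.natDegree_le_iff_degree_le.2 (Order.lt_succ_iff.1 (by exact_mod_cast this))
  refine ⟨![(x.1 : Polynomial k).homogenize d, (x.2 : Polynomial k).homogenize d], fun h => hx0 ?_,
    fun j => ?_, fun i => ?_⟩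
  · have h0 := congrFun h 0
    have h1 := congrFun h 1
    simp only [Matrix.cons_val_zero, Matrix.cons_val_one, Pi.zero_apply,
      Polynomial.homogenize_eq_zero_iff (hV _)] at h0 h1
    exact Prod.ext (Subtype.ext h0) (Subtype.ext h1)
  · fin_cases j <;> simp
  · rw [bind₁_linearForm]
    have := hT i (w i 1 • (x.1 : Polynomial k) - w i 0 • (x.2 : Polynomial k)) ?_ ?_
    · simpa [← MvPolynomial.smul_eq_C_mul] using this
    · exact (Polynomial.natDegree_sub_le _ _).trans (max_le
        ((Polynomial.natDegree_smul_le _ _).trans (hV _))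
        ((Polynomial.natDegree_smul_le _ _).trans (hV _)))
    · exact congrFun (LinearMap.mem_ker.1 hx) i

end Forms

/-! ### Numerical admissibility as absence of an inseparable pencil -/

section Numerical

theorem barDown_eq_iff {p : ℕ} (hp : 0 < p) (m e : ℕ) (z : ℤ) :
    barDown p m e = z ↔ (p : ℤ) ^ m * z ≤ e ∧ (e : ℤ) < (p : ℤ) ^ m * z + (p : ℤ) ^ m := by
  have hq : (0 : ℚ) < (p : ℚ) ^ m := by positivity
  rw [barDown, Int.floor_eq_iff, le_div_iff₀ hq, div_lt_iff₀ hq, ← mul_add_one]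
  rw [mul_comm (z : ℚ), mul_comm ((z : ℚ) + 1)]
  norm_cast

theorem barUp_eq_iff {p : ℕ} (hp : 0 < p) (m e : ℕ) (z : ℤ) :
    barUp p m e = z ↔ (p : ℤ) ^ m * z - (p : ℤ) ^ m < e ∧ (e : ℤ) ≤ (p : ℤ) ^ m * z := by
  have hq : (0 : ℚ) < (p : ℚ) ^ m := by positivity
  rw [barUp, Int.ceil_eq_iff, lt_div_iff₀ hq, div_le_iff₀ hq, ← mul_sub_one]
  rw [mul_comm (z : ℚ), mul_comm ((z : ℚ) - 1)]
  norm_cast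

theorem sum_add_sum_compl_eq_sum_ite (S : Finset (Fin 3)) (f g : Fin 3 → ℤ) :
    ∑ i ∈ S, f i + ∑ i ∈ Sᶜ, g i = ∑ i, if i ∈ S then f i else g i := by
  rw [← Finset.sum_add_sum_compl S]
  congr 1
  · exact Finset.sum_congr rfl fun i hi => by rw [if_pos hi]
  · exact Finset.sum_congr rfl fun i hi => by rw [if_neg (Finset.mem_compl.1 hi)]

/-- Numerical admissibility says that no pencil of degree `D` with ramification `ε`, pulled back
under the `m`-th power of Frobenius and multiplied by base points, is of degree at most `d`
and has the prescribed vanishing. -/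
theorem numericallyAdmissible_iff {p d : ℕ} (hp : 0 < p) {e : Fin 3 → ℕ} (he : ∀ i, 0 < e i)
    (hde : 2 * (d : ℤ) - 2 = ∑ i, ((e i : ℤ) - 1)) :
    NumericallyAdmissible p e ↔ ∀ m : ℕ, 0 < m → ∀ (ε : Fin 3 → ℕ) (D : ℕ), (∀ i, 0 < ε i) →
      ∑ i, ε i = 2 * D + 1 → d < ∑ i, (e i - p ^ m * ε i) + p ^ m * D := by
  constructor
  · intro h m hm ε D hε hsum
    by_contra! hle
    set q := p ^ m with hq
    have hqpos : 0 < q := by positivity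
    have hD : 1 ≤ D := by
      have := hε 0; have := hε 1; have := hε 2
      rw [Fin.sum_univ_three] at hsum
      omega
    have hqd : q ≤ d := (Nat.le_mul_of_pos_right q hD).trans ((Nat.le_add_left _ _).trans hle)
    have hmul : q * ε 0 + q * ε 1 + q * ε 2 = 2 * (q * D) + q := by
      rw [Fin.sum_univ_three] at hsum
      rw [← mul_add, ← mul_add, hsum]; ring
    -- Since `2 max(0, x) = |x| + x`, while `∑ e i = 2d + 1` and `∑ q ε i = 2qD + q`, the degree
    -- inequality `hle` is equivalent to `∑ |e i - q ε i| < q`.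
    have hbound : ∑ i, (if q * ε i < e i then (e i : ℤ) - q * ε i else q * ε i - e i) < q := by
      rw [Fin.sum_univ_three] at hde hle ⊢
      split_ifs <;> zify at * <;> omega
    have hterm (i) : (if q * ε i < e i then (e i : ℤ) - q * ε i else q * ε i - e i) < q := by
      refine lt_of_le_of_lt (Finset.single_le_sum (f := fun i =>
        (if q * ε i < e i then (e i : ℤ) - q * ε i else q * ε i - e i)) (fun j _ => ?_)
        (Finset.mem_univ i)) hbound
      split_ifs <;> zify at * <;> omega
    have hqz : (p : ℤ) ^ m = (q : ℤ) := by push_cast [hq]; rfl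
    -- Each `|e i - q ε i|` is less than `q`, so `ε i` is the floor of `e i / q` for `i` in `S` and
    -- the ceiling otherwise; exact multiples count as ceilings.
    let S : Finset (Fin 3) := {i | q * ε i < e i}
    have hS (i) : i ∈ S ↔ q * ε i < e i := by simp [S]
    have hdown (i) (hi : i ∈ S) : barDown p m (e i) = ε i := by
      have := hterm i
      rw [if_pos ((hS i).1 hi)] at this
      have := (hS i).1 hi
      rw [barDown_eq_iff hp, hqz]
      zify at this
      constructor <;> linarith
    have hup (i) (hi : i ∉ S) : barUp p m (e i) = ε i := by
      have := hterm i
      rw [if_neg (mt (hS i).2 hi)] at this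
      have := not_lt.1 (mt (hS i).2 hi)
      rw [barUp_eq_iff hp, hqz]
      zify at this
      constructor <;> linarith
    have key := h d m S hde hm hqd ?_ ?_
    · rw [sum_add_sum_compl_eq_sum_ite, hqz] at key
      refine absurd hbound (not_lt.2 (key.trans_eq (Finset.sum_congr rfl fun i _ => ?_)))
      by_cases hi : i ∈ S
      · rw [if_pos hi, if_pos ((hS i).1 hi), diffDown, hdown i hi, hqz]
      · rw [if_neg hi, if_neg (mt (hS i).2 hi), diffUp, hup i hi, hqz]
    · intro i hi
      exact (Nat.le_mul_of_pos_right q (hε i)).trans_lt ((hS i).1 hi)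
    · rw [sum_add_sum_compl_eq_sum_ite]
      have : ∑ i, (if i ∈ S then barDown p m (e i) else barUp p m (e i)) = ∑ i, (ε i : ℤ) :=
        Finset.sum_congr rfl fun i _ => by
          by_cases hi : i ∈ S
          · rw [if_pos hi, hdown i hi]
          · rw [if_neg hi, hup i hi]
      rw [this]
      exact ⟨D, by exact_mod_cast hsum⟩
  · intro h d' m S hd' hm hqd hS hodd
    obtain rfl : d' = d := by have := hd'.trans hde.symm; omega
    set q := p ^ m with hq
    have hqpos : 0 < q := by positivity
    have hqz : (p : ℤ) ^ m = (q : ℤ) := by push_cast [hq]; rfl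
    rw [sum_add_sum_compl_eq_sum_ite] at hodd ⊢
    have hdown (i) := (barDown_eq_iff hp m (e i) _).1 rfl
    have hup (i) := (barUp_eq_iff hp m (e i) _).1 rfl
    simp only [hqz] at hdown hup
    have hqpos' : (0 : ℤ) < q := by exact_mod_cast hqpos
    have hpos (i) : 0 < if i ∈ S then barDown p m (e i) else barUp p m (e i) := by
      split_ifs with hi
      · have h1 : (q : ℤ) < e i := by exact_mod_cast hS i hi
        have : (0 : ℤ) < q * barDown p m (e i) := by linarith [(hdown i).2]
        exact pos_of_mul_pos_right this hqpos'.le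
      · have h1 : (0 : ℤ) < e i := by exact_mod_cast he i
        exact pos_of_mul_pos_right (h1.trans_le (hup i).2) hqpos'.le
    choose ε hε using fun i => Int.eq_ofNat_of_zero_le (hpos i).le
    have hεpos (i) : 0 < ε i := by
      have := hpos i
      rw [hε i] at this
      exact_mod_cast this
    rw [Finset.sum_congr rfl fun i _ => hε i] at hodd
    obtain ⟨D, hD⟩ := hodd
    have hD0 : 0 ≤ D := by
      have := Finset.sum_nonneg (s := Finset.univ) fun i _ => Int.natCast_nonneg (ε i)
      omega
    lift D to ℕ using hD0
    have hsum : ∑ i, ε i = 2 * D + 1 := by exact_mod_cast hD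
    have key := h m hm ε D hεpos hsum
    have hmul : q * ε 0 + q * ε 1 + q * ε 2 = 2 * (q * D) + q := by
      rw [Fin.sum_univ_three] at hsum
      rw [← mul_add, ← mul_add, hsum]; ring
    -- Again `|x| = 2 max(0, x) - x`, the truncated subtraction being the positive part.
    have hterm (i) : (if i ∈ S then diffDown p m (e i) else diffUp p m (e i)) =
        2 * (e i - q * ε i : ℕ) - ((e i : ℤ) - q * ε i) := by
      have h1 := hε i
      split_ifs at h1 ⊢ with hi
      · have := (hdown i).1
        rw [diffDown, hqz, h1]
        rw [h1] at this
        omega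
      · have := (hup i).2
        rw [diffUp, hqz, h1]
        rw [h1] at this
        omega
    rw [hqz, Finset.sum_congr rfl fun i _ => hterm i]
    rw [← hq] at key
    rw [Fin.sum_univ_three] at hde key ⊢
    zify at *
    omega

end Numerical

/-! ### Wronskians, Riemann-Hurwitz and the analysis of the pencil -/

section Wronskian

open Polynomial

variable {k : Type*} [Field k]

/-- The general bound `deg W < deg a + deg b` suffices unless both degrees equal `n`; then
subtracting a multiple of `b` from `a` lowers the degree and keeps the Wronskian. -/
theorem natDegree_wronskian_add_two_le {a b : k[X]} {n : ℕ} (ha : a.natDegree ≤ n)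
    (hb : b.natDegree ≤ n) (hW : wronskian a b ≠ 0) : (wronskian a b).natDegree + 2 ≤ 2 * n := by
  have hlt := natDegree_wronskian_lt_add hW
  by_cases h : a.natDegree = n ∧ b.natDegree = n
  · obtain ⟨ha', hb'⟩ := h
    have hb0 : b ≠ 0 := by rintro rfl; simp at hW
    have ha0 : a ≠ 0 := by rintro rfl; simp at hW
    set c := a.leadingCoeff / b.leadingCoeff with hc
    have hc0 : c ≠ 0 := div_ne_zero (leadingCoeff_ne_zero.2 ha0) (leadingCoeff_ne_zero.2 hb0)
    have hW' : wronskian (a - C c * b) b = wronskian a b := by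
      simp only [wronskian, derivative_sub, derivative_C_mul]; ring
    have hne : a - C c * b ≠ 0 := by
      intro h0
      rw [h0, wronskian_zero_left] at hW'
      exact hW hW'.symm
    have hdeg : (a - C c * b).degree < a.degree := by
      refine degree_sub_lt_left ?_ ha0 ?_
      · rw [degree_C_mul hc0, degree_eq_natDegree ha0, degree_eq_natDegree hb0, ha', hb']
      · rw [leadingCoeff_mul, leadingCoeff_C, hc, div_mul_cancel₀ _ (leadingCoeff_ne_zero.2 hb0)]
    have := natDegree_lt_natDegree hne hdeg
    have := natDegree_wronskian_lt_add (hW'.trans_ne hW)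
    rw [hW'] at this
    omega
  · omega

/-- Up to a scalar, the equation of the fibre over `c` can replace one of `a`, `b` in the Wronskian,
so information on a single fibre passes to the Wronskian. -/
theorem wronskian_combination (c : Fin 2 → k) (a b : k[X]) :
    wronskian (C (c 1) * a - C (c 0) * b) a = C (c 0) * wronskian a b ∧
      wronskian (C (c 1) * a - C (c 0) * b) b = C (c 1) * wronskian a b := by
  constructor <;>
  · simp only [wronskian, derivative_sub, derivative_C_mul]; ring

theorem combination_ne_zero {c : Fin 2 → k} (hc : c ≠ 0) {a b : k[X]} (hW : wronskian a b ≠ 0) :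
    C (c 1) * a - C (c 0) * b ≠ 0 := by
  intro h
  obtain ⟨h0, h1⟩ := wronskian_combination c a b
  rw [h, wronskian_zero_left] at h0 h1
  rcases (vec_ne_zero_iff c).1 hc with h' | h'
  · exact mul_ne_zero (C_ne_zero.2 h') hW h0.symm
  · exact mul_ne_zero (C_ne_zero.2 h') hW h1.symm

/-- Riemann-Hurwitz at infinity: ramification there lowers the degree of the fibre equation, and
with it the bound on the degree of the Wronskian. -/
theorem natDegree_wronskian_lt_of_combination {c : Fin 2 → k} (hc : c ≠ 0) {a b : k[X]} {n : ℕ}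
    (ha : a.natDegree ≤ n) (hb : b.natDegree ≤ n) (hW : wronskian a b ≠ 0) :
    (wronskian a b).natDegree < (C (c 1) * a - C (c 0) * b).natDegree + n := by
  obtain ⟨h0, h1⟩ := wronskian_combination c a b
  rcases (vec_ne_zero_iff c).1 hc with h' | h'
  · have := natDegree_wronskian_lt_add (h0.trans_ne (mul_ne_zero (C_ne_zero.2 h') hW))
    rw [h0, natDegree_C_mul h'] at this
    omega
  · have := natDegree_wronskian_lt_add (h1.trans_ne (mul_ne_zero (C_ne_zero.2 h') hW))
    rw [h1, natDegree_C_mul h'] at this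
    omega

/-- Both the fibre equation and its derivative are divisible by `l ^ (r - 1)`, in every
characteristic. -/
theorem pow_sub_one_dvd_wronskian {c : Fin 2 → k} (hc : c ≠ 0) {a b l : k[X]} {r : ℕ}
    (h : l ^ r ∣ C (c 1) * a - C (c 0) * b) : l ^ (r - 1) ∣ wronskian a b := by
  obtain ⟨h0, h1⟩ := wronskian_combination c a b
  have hd (x : k[X]) : l ^ (r - 1) ∣ wronskian (C (c 1) * a - C (c 0) * b) x :=
    dvd_sub (((pow_dvd_pow l (Nat.sub_le r 1)).trans h).mul_right _)
      ((pow_sub_one_dvd_derivative_of_pow_dvd h).mul_right _)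
  rcases (vec_ne_zero_iff c).1 hc with h' | h'
  · exact ((isUnit_C.2 h'.isUnit).dvd_mul_left).1 (h0 ▸ hd a)
  · exact ((isUnit_C.2 h'.isUnit).dvd_mul_left).1 (h1 ▸ hd b)

theorem sum_le_natDegree_of_pow_dvd {ι : Type*} [Fintype ι] {t : ι → k}
    (ht : Function.Injective t) {r : ι → ℕ} {g : k[X]} (hg : g ≠ 0)
    (h : ∀ i, (X - C (t i)) ^ r i ∣ g) : ∑ i, r i ≤ g.natDegree := by
  have hdvd : ∏ i, (X - C (t i)) ^ r i ∣ g :=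
    Finset.prod_dvd_of_coprime
      (fun i _ j _ hij => (pairwise_coprime_X_sub_C ht hij).pow) fun i _ => h i
  refine le_trans (le_of_eq ?_) (natDegree_le_of_dvd hdvd hg)
  rw [natDegree_prod _ _ fun i _ => pow_ne_zero _ (X_sub_C_ne_zero _)]
  simp

/-- Half of the Riemann-Hurwitz formula. -/
theorem sum_sub_one_le_natDegree_wronskian {ι : Type*} [Fintype ι] {t : ι → k}
    (ht : Function.Injective t) {r : ι → ℕ} {w : ι → Fin 2 → k} (hw : ∀ i, w i ≠ 0) {a b : k[X]}
    (hW : wronskian a b ≠ 0) (h : ∀ i, (X - C (t i)) ^ r i ∣ C (w i 1) * a - C (w i 0) * b) :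
    ∑ i, (r i - 1) ≤ (wronskian a b).natDegree :=
  sum_le_natDegree_of_pow_dvd ht hW fun i => pow_sub_one_dvd_wronskian (hw i) (h i)

/-- A rational function factors as a separable one after a power of Frobenius. -/
theorem exists_expand_wronskian_ne_zero (p : ℕ) [Fact p.Prime] [CharP k p] (n : ℕ) {a b : k[X]}
    (hab : IsCoprime a b) (hn : max a.natDegree b.natDegree = n) (hn0 : 0 < n) :
    ∃ (m : ℕ) (a' b' : k[X]), a = expand k (p ^ m) a' ∧ b = expand k (p ^ m) b' ∧
      wronskian a' b' ≠ 0 := by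
  have hp : p.Prime := Fact.out
  induction n using Nat.strong_induction_on generalizing a b with
  | _ n ih =>
  by_cases hW : wronskian a b = 0
  · obtain ⟨ha, hb⟩ := hab.wronskian_eq_zero_iff.1 hW
    have ha' := expand_contract p ha hp.ne_zero
    have hb' := expand_contract p hb hp.ne_zero
    rw [← ha', ← hb', isCoprime_expand hp.ne_zero] at hab
    rw [← ha', ← hb', natDegree_expand, natDegree_expand,
      ← max_mul_of_nonneg _ _ (Nat.zero_le p)] at hn
    have hpos : 0 < max (contract p a).natDegree (contract p b).natDegree := by
      by_contra h0
      rw [Nat.eq_zero_of_not_pos h0, zero_mul] at hn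
      omega
    obtain ⟨m, a', b', h1, h2, h3⟩ := ih _
      (by rw [← hn]; exact lt_mul_of_one_lt_right hpos hp.one_lt) hab rfl hpos
    refine ⟨m + 1, a', b', ?_, ?_, h3⟩
    · rw [← ha', h1, expand_expand, pow_succ']
    · rw [← hb', h2, expand_expand, pow_succ']
  · exact ⟨0, a, b, by simp, by simp, hW⟩

theorem exists_eq_gcd_mul {a b : k[X]} (hab : a ≠ 0 ∨ b ≠ 0) :
    ∃ g a₁ b₁ : k[X], g ≠ 0 ∧ IsCoprime a₁ b₁ ∧ a = g * a₁ ∧ b = g * b₁ := by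
  classical
  let := EuclideanDomain.gcdMonoid k[X]
  have hg : GCDMonoid.gcd a b ≠ 0 := by
    rw [Ne, gcd_eq_zero_iff]; tauto
  exact ⟨GCDMonoid.gcd a b, a / GCDMonoid.gcd a b, b / GCDMonoid.gcd a b, hg,
    isCoprime_div_gcd_div_gcd_of_gcd_ne_zero hg,
    (EuclideanDomain.mul_div_cancel' hg (GCDMonoid.gcd_dvd_left _ _)).symm,
    (EuclideanDomain.mul_div_cancel' hg (GCDMonoid.gcd_dvd_right _ _)).symm⟩

/-- A constant pencil lies over at most one `Q i`, so `g` would carry the full vanishing at two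
points and `e i + e j ≤ d`. With the third index at most `d`, this contradicts the sum `2d + 1`. -/
theorem max_natDegree_pos {d : ℕ}
    {e : Fin 3 → ℕ} (hde : ∑ i, e i = 2 * d + 1) (hle : ∀ i, e i ≤ d)
    {t : Fin 3 → k} (ht : Function.Injective t) {w : Fin 3 → Fin 2 → k}
    (hww : ∀ i j, i ≠ j → det₂ (w i) (w j) ≠ 0) {g a₁ b₁ : k[X]} (hg0 : g ≠ 0)
    (hgd : g.natDegree ≤ d) (hcop : IsCoprime a₁ b₁)
    (h : ∀ i, (X - C (t i)) ^ e i ∣ g * (C (w i 1) * a₁ - C (w i 0) * b₁)) :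
    0 < max a₁.natDegree b₁.natDegree := by
  by_contra h0
  have h0 : a₁.natDegree = 0 ∧ b₁.natDegree = 0 := by omega
  obtain ⟨x, rfl⟩ := natDegree_eq_zero.1 h0.1
  obtain ⟨y, rfl⟩ := natDegree_eq_zero.1 h0.2
  have hxy : (![x, y] : Fin 2 → k) ≠ 0 := by
    rw [vec_ne_zero_iff]
    by_contra! hxy
    simp only [Matrix.cons_val_zero, Matrix.cons_val_one] at hxy
    simp [hxy.1, hxy.2, isCoprime_zero_left] at hcop
  have hdet (i) (hi : det₂ ![x, y] (w i) ≠ 0) : (X - C (t i)) ^ e i ∣ g := by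
    have h1 := h i
    have : C (w i 1) * C x - C (w i 0) * C y = C (det₂ ![x, y] (w i)) := by
      rw [← C_mul, ← C_mul, ← C_sub]
      congr 1
      simp [det₂]; ring
    rw [this] at h1
    exact (isUnit_C.2 hi.isUnit).dvd_mul_right.1 h1
  have hpair (i j) (hij : i ≠ j) : det₂ ![x, y] (w i) ≠ 0 ∨ det₂ ![x, y] (w j) ≠ 0 := by
    by_contra! h2
    have e0 : x * det₂ (w i) (w j) = 0 := by
      have h3 := h2.1; have h4 := h2.2
      simp only [det₂, Matrix.cons_val_zero, Matrix.cons_val_one] at h3 h4 ⊢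
      linear_combination w i 0 * h4 - w j 0 * h3
    have e1 : y * det₂ (w i) (w j) = 0 := by
      have h3 := h2.1; have h4 := h2.2
      simp only [det₂, Matrix.cons_val_zero, Matrix.cons_val_one] at h3 h4 ⊢
      linear_combination w i 1 * h4 - w j 1 * h3
    rcases (vec_ne_zero_iff _).1 hxy with h' | h'
    · exact hww i j hij ((mul_eq_zero.1 e0).resolve_left h')
    · exact hww i j hij ((mul_eq_zero.1 e1).resolve_left h')
  have htwo (i j) (hij : i ≠ j) (hi : det₂ ![x, y] (w i) ≠ 0) (hj : det₂ ![x, y] (w j) ≠ 0) :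
      e i + e j ≤ d := by
    have := sum_le_natDegree_of_pow_dvd (t := fun l : Fin 2 => t (![i, j] l))
      (r := fun l => e (![i, j] l)) (ht.comp ?_) hg0 (fun l => hdet _ ?_)
    · simp only [Fin.sum_univ_two, Matrix.cons_val_zero, Matrix.cons_val_one] at this
      omega
    · intro l l' hll
      fin_cases l <;> fin_cases l' <;> simp_all
    · fin_cases l <;> simp [hi, hj]
  rw [Fin.sum_univ_three] at hde
  have := hle 0; have := hle 1; have := hle 2
  have p01 := hpair 0 1 (by decide)
  have p02 := hpair 0 2 (by decide)
  have p12 := hpair 1 2 (by decide)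
  have t01 := htwo 0 1 (by decide)
  have t02 := htwo 0 2 (by decide)
  have t12 := htwo 1 2 (by decide)
  have : e 0 + e 1 ≤ d ∨ e 0 + e 2 ≤ d ∨ e 1 + e 2 ≤ d := by tauto
  omega

/-- The pencil with prescribed vanishing of high order at three points defines a separable
function, without base points, if no inseparable pencil has the prescribed vanishing. -/
theorem isCoprime_and_wronskian_ne_zero (p : ℕ) [Fact p.Prime] [CharP k p] {d : ℕ}
    {e : Fin 3 → ℕ} (hde : ∑ i, e i = 2 * d + 1) (hle : ∀ i, e i ≤ d)
    (hadm : ∀ m : ℕ, 0 < m → ∀ (ε : Fin 3 → ℕ) (D : ℕ), (∀ i, 0 < ε i) →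
      ∑ i, ε i = 2 * D + 1 → d < ∑ i, (e i - p ^ m * ε i) + p ^ m * D)
    {t : Fin 3 → k} (ht : Function.Injective t) {w : Fin 3 → Fin 2 → k} (hw : ∀ i, w i ≠ 0)
    (hww : ∀ i j, i ≠ j → det₂ (w i) (w j) ≠ 0) {a b : k[X]} (hab : a ≠ 0 ∨ b ≠ 0)
    (ha : a.natDegree ≤ d) (hb : b.natDegree ≤ d)
    (h : ∀ i, (X - C (t i)) ^ e i ∣ C (w i 1) * a - C (w i 0) * b) :
    IsCoprime a b ∧ wronskian a b ≠ 0 ∧ max a.natDegree b.natDegree = d := by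
  have hp : p.Prime := Fact.out
  obtain ⟨g, a₁, b₁, hg0, hcop, rfl, rfl⟩ := exists_eq_gcd_mul hab
  have hmul (c : Fin 2 → k) : C (c 1) * (g * a₁) - C (c 0) * (g * b₁) =
      g * (C (c 1) * a₁ - C (c 0) * b₁) := by ring
  simp only [hmul] at h
  have hgd : g.natDegree + max a₁.natDegree b₁.natDegree ≤ d := by
    have key (x : k[X]) (hx : (g * x).natDegree ≤ d) (hx0 : x ≠ 0) :
        g.natDegree + x.natDegree ≤ d := by rwa [← natDegree_mul hg0 hx0]
    by_cases ha0 : a₁ = 0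
    · subst ha0
      simpa using key b₁ hb (by simpa [hg0] using hab)
    · have h1 := key a₁ ha ha0
      by_cases hb0 : b₁ = 0
      · simpa [hb0] using h1
      · have h2 := key b₁ hb hb0
        omega
  have hpos : 0 < max a₁.natDegree b₁.natDegree := by
    exact max_natDegree_pos hde hle ht hww hg0 (by omega) hcop h
  obtain ⟨m, A, B, rfl, rfl, hW⟩ := exists_expand_wronskian_ne_zero p _ hcop rfl hpos
  set D := max A.natDegree B.natDegree with hD
  rw [natDegree_expand, natDegree_expand, ← max_mul_of_nonneg _ _ (Nat.zero_le _), ← hD,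
    mul_comm D] at hgd hpos
  have hWdeg := natDegree_wronskian_add_two_le (le_max_left _ _) (le_max_right _ _) hW
  rw [← hD] at hWdeg
  set q := p ^ m with hq
  have hqpos : 0 < q := pow_pos hp.pos m
  let r (i : Fin 3) : ℕ := rootMultiplicity (t i ^ q) (C (w i 1) * A - C (w i 0) * B)
  let s (i : Fin 3) : ℕ := rootMultiplicity (t i) g
  -- `expand` acts on the variable and not on coefficients: the source points become `t i ^ q`,
  -- while the targets `w i` stay.
  have htq : Function.Injective fun i => t i ^ q := by
    intro i j hij
    exact ht (iterateFrobenius_inj k p m (by simpa [iterateFrobenius_def] using hij))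
  have hr : ∑ i, (r i - 1) + 2 ≤ 2 * D :=
    (Nat.add_le_add_right (sum_sub_one_le_natDegree_wronskian htq hw hW fun i =>
      pow_rootMultiplicity_dvd _ _) 2).trans hWdeg
  have hs : ∑ i, s i ≤ g.natDegree :=
    sum_le_natDegree_of_pow_dvd ht hg0 fun i => pow_rootMultiplicity_dvd _ _
  have he (i) : e i ≤ s i + q * r i := by
    have hne := combination_ne_zero (hw i) hW
    have hexp : C (w i 1) * expand k q A - C (w i 0) * expand k q B =
        expand k q (C (w i 1) * A - C (w i 0) * B) := by simp
    have hne' : g * expand k q (C (w i 1) * A - C (w i 0) * B) ≠ 0 :=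
      mul_ne_zero hg0 ((expand_ne_zero hqpos).2 hne)
    have := h i
    rw [hexp, ← le_rootMultiplicity_iff hne', rootMultiplicity_mul hne', hq,
      rootMultiplicity_expand_pow] at this
    exact this
  -- Riemann-Hurwitz gives `≤`, because `(r - 1) + 1 = max 1 r` for truncated subtraction. If the
  -- sum were at most `2D`, then `he` would give `2d + 1 ≤ deg g + 2qD ≤ 2d`.
  have hsum : ∑ i, max 1 (r i) = 2 * D + 1 := by
    have h0 := he 0; have h1 := he 1; have h2 := he 2
    have hmono (i) : q * r i ≤ q * max 1 (r i) := Nat.mul_le_mul_left q (le_max_right _ _)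
    have m0 := hmono 0; have m1 := hmono 1; have m2 := hmono 2
    rw [Fin.sum_univ_three] at hde hr hs ⊢
    by_contra hne
    have hlt : max 1 (r 0) + max 1 (r 1) + max 1 (r 2) ≤ 2 * D := by omega
    have := Nat.mul_le_mul_left q hlt
    rw [mul_add, mul_add, mul_left_comm] at this
    omega
  have hq1 : m = 0 := by
    by_contra hm
    have := hadm m (Nat.pos_of_ne_zero hm) (fun i => max 1 (r i)) D (fun i => by positivity) hsum
    refine absurd this (not_lt.2 (le_trans (Nat.add_le_add_right ?_ _) hgd))
    refine le_trans (Finset.sum_le_sum fun i _ => ?_) hs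
    have := (he i).trans (Nat.add_le_add_left (Nat.mul_le_mul_left q (le_max_right 1 (r i))) _)
    rw [← hq]
    omega
  subst hq1
  simp only [pow_zero] at hq
  rw [hq] at he hgd
  -- For `q = 1`, `2d + 1 ≤ deg g + 2D + 1`, whereas `deg g + D ≤ d`.
  have hG : g.natDegree = 0 ∧ D = d := by
    have h0 := he 0; have h1 := he 1; have h2 := he 2
    rw [Fin.sum_univ_three] at hde hsum hs
    omega
  obtain ⟨c, rfl⟩ := natDegree_eq_zero.1 hG.1
  have hc : c ≠ 0 := fun h0 => hg0 (by simp [h0])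
  simp only [hq, expand_one] at hcop ⊢
  refine ⟨(isCoprime_mul_unit_left (isUnit_C.2 hc.isUnit) A B).2 hcop, ?_, ?_⟩
  · have : wronskian (C c * A) (C c * B) = C (c * c) * wronskian A B := by
      simp only [wronskian, derivative_C_mul, C_mul]; ring
    rw [this]
    exact mul_ne_zero (C_ne_zero.2 (mul_ne_zero hc hc)) hW
  · rw [natDegree_C_mul hc, natDegree_C_mul hc, ← hG.2]

end Wronskian

/-! ### Degree and separability of `k(x)` over `k(f)` -/

section FunctionField

open Polynomial

variable {k : Type*} [Field k]

theorem natDegree_num_denom_div {a b : k[X]} (hab : IsCoprime a b) (hb : b ≠ 0) :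
    (algebraMap k[X] (RatFunc k) a / algebraMap k[X] (RatFunc k) b).num.natDegree = a.natDegree ∧
    (algebraMap k[X] (RatFunc k) a / algebraMap k[X] (RatFunc k) b).denom.natDegree =
      b.natDegree := by
  set f := algebraMap k[X] (RatFunc k) a / algebraMap k[X] (RatFunc k) b with hf
  have h : f.num * b = a * f.denom := (RatFunc.num_mul_eq_mul_denom_iff hb).2 hf
  have h1 : a ∣ f.num := hab.dvd_of_dvd_mul_right (h ▸ dvd_mul_right _ _)
  have h2 : f.num ∣ a := f.isCoprime_num_denom.dvd_of_dvd_mul_right (h.symm ▸ dvd_mul_right _ _)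
  have h3 : b ∣ f.denom := hab.symm.dvd_of_dvd_mul_left (h ▸ dvd_mul_left _ _)
  have h4 : f.denom ∣ b :=
    f.isCoprime_num_denom.symm.dvd_of_dvd_mul_left (h.symm ▸ dvd_mul_left _ _)
  exact ⟨natDegree_eq_of_degree_eq (degree_eq_degree_of_associated (associated_of_dvd_dvd h2 h1)),
    natDegree_eq_of_degree_eq (degree_eq_degree_of_associated (associated_of_dvd_dvd h4 h3))⟩

theorem finrank_adjoin_div {a b : k[X]} (hab : IsCoprime a b) :
    Module.finrank k⟮algebraMap k[X] (RatFunc k) a / algebraMap k[X] (RatFunc k) b⟯ (RatFunc k) =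
      max a.natDegree b.natDegree := by
  rw [RatFunc.finrank_eq_max_natDegree]
  by_cases hb : b = 0
  · subst hb
    have := natDegree_eq_zero_of_isUnit (isCoprime_zero_right.1 hab)
    simp [this]
  · obtain ⟨h1, h2⟩ := natDegree_num_denom_div hab hb
    rw [h1, h2]

/-- `x` is a root of `a(T) - f b(T)` over `k(f)`, and the derivative of this polynomial at `x` is
`-W / b`, so `x` is separable and generates `k(x)`. -/
theorem isSeparable_adjoin_div {a b : k[X]} (hW : wronskian a b ≠ 0) :
    Algebra.IsSeparable k⟮algebraMap k[X] (RatFunc k) a / algebraMap k[X] (RatFunc k) b⟯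
      (RatFunc k) := by
  set f := algebraMap k[X] (RatFunc k) a / algebraMap k[X] (RatFunc k) b with hf
  set K := k⟮f⟯ with hK
  have hb0 : b ≠ 0 := by rintro rfl; simp at hW
  have hb : algebraMap k[X] (RatFunc k) b ≠ 0 := RatFunc.algebraMap_ne_zero hb0
  let P : K[X] := a.map (algebraMap k K) - C ⟨f, IntermediateField.mem_adjoin_simple_self k f⟩ *
    b.map (algebraMap k K)
  have haeval (g : k[X]) : aeval (RatFunc.X : RatFunc k) (g.map (algebraMap k K)) =
      algebraMap k[X] (RatFunc k) g := by
    rw [aeval_map_algebraMap, RatFunc.aeval_X_left_eq_algebraMap]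
  have hP : aeval (RatFunc.X : RatFunc k) P = 0 := by
    simp only [P, map_sub, map_mul, haeval, aeval_C]
    change _ - f * _ = 0
    rw [hf, div_mul_cancel₀ _ hb, sub_self]
  have hP' : aeval (RatFunc.X : RatFunc k) (derivative P) ≠ 0 := by
    simp only [P, derivative_C_mul, derivative_map, map_sub, map_mul, haeval,
      aeval_C]
    change _ - f * _ ≠ 0
    rw [hf]
    intro h
    have h2 : algebraMap k[X] (RatFunc k) (wronskian a b) = 0 := by
      simp only [wronskian, map_sub, map_mul]
      field_simp at h
      linear_combination -h
    exact hW ((map_eq_zero_iff _ (RatFunc.algebraMap_injective k)).1 h2)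
  have hP0 : P ≠ 0 := by
    intro h
    rw [h] at hP'
    simp at hP'
  have hint : IsIntegral K (RatFunc.X : RatFunc k) := IsAlgebraic.isIntegral ⟨P, hP0, hP⟩
  have hsep : IsSeparable K (RatFunc.X : RatFunc k) := by
    rw [IsSeparable, Polynomial.separable_iff_derivative_ne_zero (minpoly.irreducible hint)]
    intro h0
    obtain ⟨R, hR⟩ := minpoly.dvd K _ hP
    apply hP'
    rw [hR, derivative_mul, h0, zero_mul, zero_add, map_mul, minpoly.aeval, zero_mul]
  have : Algebra.IsSeparable K K⟮(RatFunc.X : RatFunc k)⟯ :=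
    (IntermediateField.isSeparable_adjoin_simple_iff_isSeparable K _).2 hsep
  exact AlgEquiv.Algebra.isSeparable (RatFunc.IntermediateField.adjoinXEquiv K)

theorem algebraMap_expand_mem (p : ℕ) (g : k[X]) :
    algebraMap k[X] (RatFunc k) (expand k p g) ∈ k⟮(RatFunc.X : RatFunc k) ^ p⟯ := by
  have : algebraMap k[X] (RatFunc k) (expand k p g) = aeval ((RatFunc.X : RatFunc k) ^ p) g := by
    rw [← RatFunc.aeval_X_left_eq_algebraMap, expand_aeval]
  rw [this]
  exact IntermediateField.algebra_adjoin_le_adjoin k _ (aeval_mem_adjoin_singleton k _)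

/-- A subfield over which `k(x)` is separable is not contained in the image `k(x ^ p)` of
Frobenius. -/
theorem not_le_adjoin_X_pow (p : ℕ) [Fact p.Prime] [CharP k p]
    (K : IntermediateField k (RatFunc k)) [Algebra.IsSeparable K (RatFunc k)] :
    ¬ K ≤ k⟮(RatFunc.X : RatFunc k) ^ p⟯ := by
  intro hle
  have hp : p.Prime := Fact.out
  set E := k⟮(RatFunc.X : RatFunc k) ^ p⟯ with hE
  let : Algebra K E := (IntermediateField.inclusion hle).toRingHom.toAlgebra
  have : IsScalarTower K E (RatFunc k) := IsScalarTower.of_algebraMap_eq fun _ => rfl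
  have : Algebra.IsSeparable E (RatFunc k) := Algebra.isSeparable_tower_top_of_isSeparable K E _
  have : ExpChar E p := expChar_of_injective_algebraMap (algebraMap k E).injective p
  -- Over `E = k(x ^ p)`, `x` is purely inseparable as well as separable, hence in `E`; but `k(x)`
  -- has degree `p` over `E`.
  have hmem : (RatFunc.X : RatFunc k) ∈ perfectClosure E (RatFunc k) := by
    rw [mem_perfectClosure_iff_pow_mem p]
    exact ⟨1, ⟨⟨_, IntermediateField.mem_adjoin_simple_self k _⟩, by simp⟩⟩
  rw [perfectClosure.eq_bot_of_isSeparable, IntermediateField.mem_bot] at hmem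
  obtain ⟨y, hy⟩ := hmem
  have hX : (RatFunc.X : RatFunc k) ∈ E := by rw [← hy]; exact y.2
  have htop : E = ⊤ := by
    rw [eq_top_iff, ← RatFunc.adjoin_X]
    exact IntermediateField.adjoin_simple_le_iff.2 hX
  have h1 := finrank_adjoin_div (k := k) (a := X ^ p) (b := 1) isCoprime_one_right
  rw [map_pow, RatFunc.algebraMap_X, map_one, div_one, ← hE, htop] at h1
  simp at h1
  exact hp.one_lt.ne h1

end FunctionField

/-! ### Morphisms and pencils without base points -/

section Morphisms

open MvPolynomial

variable {k : Type*} [Field k]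

theorem aeval_ratFunc_X_one (Φ : MvPolynomial (Fin 2) k) :
    aeval ![(RatFunc.X : RatFunc k), 1] Φ = algebraMap (Polynomial k) (RatFunc k) (dehom Φ) := by
  induction Φ using MvPolynomial.induction_on with
  | C a => simp [RatFunc.algebraMap_eq_C]
  | add p q hp hq => simp [hp, hq]
  | mul_X p i hp => fin_cases i <;> simp [hp]

theorem eval_smul {n : ℕ} {Φ : MvPolynomial (Fin 2) k} (h : Φ.IsHomogeneous n) (c : k)
    (v : Fin 2 → k) : eval (c • v) Φ = c ^ n * eval v Φ := by
  simp only [eval_eq', Finset.mul_sum]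
  refine Finset.sum_congr rfl fun m hm => ?_
  have hdeg := h (mem_support_iff.mp hm)
  simp only [Finsupp.weight_apply, Finsupp.sum_fintype, Pi.one_apply, smul_eq_mul, mul_one,
    implies_true, Fin.sum_univ_two] at hdeg
  simp only [Fin.prod_univ_two, Pi.smul_apply, smul_eq_mul, mul_pow, ← hdeg, pow_add]
  ring

variable [IsAlgClosed k]

theorem Mor.coord_eq (f : Mor k) : f.coord =
    algebraMap (Polynomial k) (RatFunc k) (dehom (f.F 0)) /
      algebraMap (Polynomial k) (RatFunc k) (dehom (f.F 1)) := by
  rw [Mor.coord, aeval_ratFunc_X_one, aeval_ratFunc_X_one]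

theorem Mor.isCoprime_dehom (f : Mor k) : IsCoprime (dehom (f.F 0)) (dehom (f.F 1)) := by
  rw [Polynomial.isCoprime_iff_aeval_ne_zero_of_isAlgClosed k k]
  intro x
  by_contra! h
  refine f.no_common_zero ![x, 1] (by simp) (funext fun j => ?_)
  rw [eval_eq_eval_dehom, Pi.zero_apply]
  fin_cases j
  · simpa using h.1
  · simpa using h.2

/-- If both degrees dropped, the point at infinity would be a common zero. -/
theorem Mor.max_natDegree_dehom (f : Mor k) :
    max (dehom (f.F 0)).natDegree (dehom (f.F 1)).natDegree = f.formDegree := by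
  refine le_antisymm (max_le (natDegree_dehom_le (f.isHomogeneous 0))
    (natDegree_dehom_le (f.isHomogeneous 1))) ?_
  by_contra! h
  refine f.no_common_zero ![1, 0] (by simp) (funext fun j => ?_)
  rw [eval_infty (f.isHomogeneous j), Pi.zero_apply]
  refine Polynomial.coeff_eq_zero_of_natDegree_lt ?_
  fin_cases j
  · exact (le_max_left _ _).trans_lt h
  · exact (le_max_right _ _).trans_lt h

theorem Mor.degree_eq_formDegree (f : Mor k) : f.degree = f.formDegree := by
  rw [← f.max_natDegree_dehom, ← finrank_adjoin_div f.isCoprime_dehom, ← Mor.coord_eq]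
  rfl

/-- The morphism defined by a pencil without base points. -/
def Mor.ofCoprime {d : ℕ} (F : Fin 2 → MvPolynomial (Fin 2) k) (hF : ∀ j, (F j).IsHomogeneous d)
    (hcop : IsCoprime (dehom (F 0)) (dehom (F 1)))
    (hd : max (dehom (F 0)).natDegree (dehom (F 1)).natDegree = d) : Mor k where
  formDegree := d
  F := F
  isHomogeneous := hF
  no_common_zero v hv hz := by
    have hz' (j) : eval v (F j) = 0 := congrFun hz j
    by_cases h1 : v 1 = 0
    · have h0 : v 0 ≠ 0 := ((vec_ne_zero_iff v).1 hv).resolve_right (not_not.2 h1)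
      have hcoeff (j) : (dehom (F j)).coeff d = 0 := by
        have := hz' j
        rw [show v = v 0 • ![1, 0] by ext i; fin_cases i <;> simp [h1], eval_smul (hF j),
          eval_infty (hF j)] at this
        exact (mul_eq_zero.1 this).resolve_left (pow_ne_zero _ h0)
      have hlt (j) : (dehom (F j)).natDegree = d → d = 0 ∧ dehom (F j) = 0 := by
        intro hj
        have h2 := hcoeff j
        rw [← hj, Polynomial.coeff_natDegree, Polynomial.leadingCoeff_eq_zero] at h2
        rw [h2, Polynomial.natDegree_zero] at hj
        exact ⟨hj.symm, h2⟩
      have hd0 : d = 0 := by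
        rcases max_choice (dehom (F 0)).natDegree (dehom (F 1)).natDegree with h | h
        · exact (hlt 0 (h.symm.trans hd)).1
        · exact (hlt 1 (h.symm.trans hd)).1
      have hall (j) : dehom (F j) = 0 := by
        refine (hlt j ?_).2
        have := natDegree_dehom_le (hF j)
        omega
      rw [hall, hall] at hcop
      exact not_isCoprime_zero_zero hcop
    · have hroot (j) : (dehom (F j)).eval (v 0 / v 1) = 0 := by
        have := hz' j
        rw [show v = v 1 • ![v 0 / v 1, 1] by ext i; fin_cases i <;> simp [mul_div_cancel₀, h1],
          eval_smul (hF j), eval_eq_eval_dehom] at this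
        exact (mul_eq_zero.1 this).resolve_left (pow_ne_zero _ h1)
      obtain ⟨a, b, hab⟩ := hcop
      have := congrArg (Polynomial.eval (v 0 / v 1)) hab
      simp [hroot] at this

end Morphisms

/-! ### Points, vanishing of forms, and Frobenius -/

section Points

open MvPolynomial

variable {k : Type*} [Field k]

theorem mk_eq_mk_iff_det₂ {u v : Fin 2 → k} (hu : u ≠ 0) (hv : v ≠ 0) :
    Projectivization.mk k u hu = Projectivization.mk k v hv ↔ det₂ u v = 0 := by
  rw [Projectivization.mk_eq_mk_iff']
  constructor
  · rintro ⟨a, rfl⟩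
    simp [det₂]; ring
  · intro h
    simp only [det₂, sub_eq_zero] at h
    rcases (vec_ne_zero_iff v).1 hv with h0 | h1
    · refine ⟨u 0 / v 0, funext (Fin.forall_fin_two.2 ⟨?_, ?_⟩)⟩ <;> simp <;> field_simp
      linear_combination h
    · refine ⟨u 1 / v 1, funext (Fin.forall_fin_two.2 ⟨?_, ?_⟩)⟩ <;> simp <;> field_simp
      linear_combination -h

theorem det₂_rep_eq_zero_iff (P P' : P1 k) : det₂ P.rep P'.rep = 0 ↔ P = P' := by
  rw [← mk_eq_mk_iff_det₂ P.rep_nonzero P'.rep_nonzero, Projectivization.mk_rep,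
    Projectivization.mk_rep]

theorem mk_eq_iff_det₂_rep {u : Fin 2 → k} (hu : u ≠ 0) (P : P1 k) :
    Projectivization.mk k u hu = P ↔ det₂ u P.rep = 0 := by
  rw [← mk_eq_mk_iff_det₂ hu P.rep_nonzero, Projectivization.mk_rep]

theorem linForm_eq (P : P1 k) [IsAlgClosed k] : linForm P = linearForm P.rep := rfl

theorem associated_linearForm_rep_mk {u : Fin 2 → k} (hu : u ≠ 0) :
    Associated (linearForm (Projectivization.mk k u hu).rep) (linearForm u) := by
  obtain ⟨a, ha⟩ := Projectivization.exists_smul_eq_mk_rep k u hu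
  rw [← ha, Units.smul_def, linearForm_smul]
  exact (associated_unit_mul_left _ _ (a.isUnit.map C))

theorem eval_bind₁_linearForm (F : Fin 2 → MvPolynomial (Fin 2) k) (w v : Fin 2 → k) :
    eval v (bind₁ F (linearForm w)) = det₂ (fun j => eval v (F j)) w := by
  rw [bind₁_linearForm]
  simp [det₂]; ring

theorem isHomogeneous_bind₁_linearForm {n : ℕ} {F : Fin 2 → MvPolynomial (Fin 2) k}
    (hF : ∀ j, (F j).IsHomogeneous n) (w : Fin 2 → k) :
    (bind₁ F (linearForm w)).IsHomogeneous n := by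
  rw [bind₁_linearForm]
  exact ((hF 0).C_mul _).sub ((hF 1).C_mul _)

theorem linearForm_dvd_of_eval_eq_zero {n : ℕ} {Φ : MvPolynomial (Fin 2) k}
    (hΦ : Φ.IsHomogeneous n) {v : Fin 2 → k} (hv : v ≠ 0) (h : eval v Φ = 0) :
    linearForm v ∣ Φ := by
  rw [← homogenize_dehom hΦ, ← pow_one (linearForm v)]
  by_cases h1 : v 1 = 0
  · have h0 : v 0 ≠ 0 := ((vec_ne_zero_iff v).1 hv).resolve_right (not_not.2 h1)
    rw [show v = v 0 • ![1, 0] by ext i; fin_cases i <;> simp [h1], eval_smul hΦ,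
      eval_infty hΦ] at h
    have h' := (mul_eq_zero.1 h).resolve_left (pow_ne_zero _ h0)
    by_cases hz : dehom Φ = 0
    · simp [hz]
    · refine linearForm_pow_dvd_homogenize_infty h1 h0 ?_
      refine lt_of_le_of_ne (natDegree_dehom_le hΦ) fun hn => hz ?_
      rwa [← hn, Polynomial.coeff_natDegree, Polynomial.leadingCoeff_eq_zero] at h'
  · refine linearForm_pow_dvd_homogenize h1 (natDegree_dehom_le hΦ) ?_
    rw [show v = v 1 • ![v 0 / v 1, 1] by ext i; fin_cases i <;> simp [mul_div_cancel₀, h1],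
      eval_smul hΦ, eval_eq_eval_dehom] at h
    rw [pow_one, Polynomial.dvd_iff_isRoot]
    exact (mul_eq_zero.1 h).resolve_left (pow_ne_zero _ h1)

theorem dehom_bind₁_linearForm (F : Fin 2 → MvPolynomial (Fin 2) k) (w : Fin 2 → k) :
    dehom (bind₁ F (linearForm w)) =
      Polynomial.C (w 1) * dehom (F 0) - Polynomial.C (w 0) * dehom (F 1) := by
  rw [bind₁_linearForm]; simp

theorem X_sub_C_pow_dvd_dehom {v : Fin 2 → k} (hv : v 1 ≠ 0) {n : ℕ}
    {Φ : MvPolynomial (Fin 2) k} (h : linearForm v ^ n ∣ Φ) :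
    (Polynomial.X - Polynomial.C (v 0 / v 1)) ^ n ∣ dehom Φ := by
  have := map_dvd dehom h
  rw [map_pow, dehom_linearForm_eq_C_mul hv] at this
  exact (pow_dvd_pow_of_dvd (dvd_mul_left _ _) n).trans this

/-- The linear form of the point at infinity dehomogenizes to a constant, so each such factor costs
one degree. -/
theorem natDegree_dehom_add_le {v : Fin 2 → k} (hv : v ≠ 0) (hv1 : v 1 = 0) {n r : ℕ}
    {Φ : MvPolynomial (Fin 2) k} (hΦ : Φ.IsHomogeneous n) (hΦ0 : Φ ≠ 0)
    (h : linearForm v ^ r ∣ Φ) : (dehom Φ).natDegree + r ≤ n := by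
  obtain ⟨Ψ, rfl⟩ := h
  have hΨ : Ψ ≠ 0 := right_ne_zero_of_mul hΦ0
  have hl := linearForm_ne_zero hv
  have hdeg := totalDegree_mul_of_isDomain (pow_ne_zero r hl) hΨ
  have hpow : (linearForm v ^ r).totalDegree = r := by
    have := ((linearForm_isHomogeneous v).pow r).totalDegree (pow_ne_zero r hl)
    simpa using this
  rw [hΦ.totalDegree hΦ0, hpow] at hdeg
  have hc : dehom (linearForm v) = Polynomial.C (-v 0) := by
    rw [dehom_linearForm, hv1]; simp
  rw [map_mul, map_pow, hc, ← Polynomial.C_pow]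
  have h1 := Polynomial.natDegree_C_mul_le ((-v 0) ^ r) (dehom Ψ)
  have h2 := natDegree_dehom_le_totalDegree Ψ
  omega

theorem dehom_expand (q : ℕ) (Φ : MvPolynomial (Fin 2) k) :
    dehom (expand q Φ) = Polynomial.expand k q (dehom Φ) := by
  induction Φ using MvPolynomial.induction_on with
  | C a => simp
  | add p q hp hq => simp [hp, hq]
  | mul_X p i hp => fin_cases i <;> simp [hp]

theorem expand_linearForm_pow (p m : ℕ) [Fact p.Prime] [CharP k p] (v : Fin 2 → k) :
    expand (p ^ m) (linearForm fun j => v j ^ p ^ m) = linearForm v ^ p ^ m := by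
  rw [linearForm, linearForm, sub_pow_char_pow]
  simp [mul_pow]

end Points

/-! ### Necessity of numerical admissibility -/

section Covers

open MvPolynomial

variable {k : Type*} [Field k] [IsAlgClosed k]

theorem Mor.map_eq_iff (f : Mor k) (P Q : P1 k) :
    f.map P = Q ↔ eval P.rep (bind₁ f.F (linForm Q)) = 0 := by
  rw [Mor.map, mk_eq_iff_det₂_rep, linForm_eq, eval_bind₁_linearForm]

theorem IsCoverWith.exists_points {d : ℕ} {e : Fin 3 → ℕ} {Q : Fin 3 → P1 k}
    (hQ : Function.Injective Q) {f : Mor k} (hf : IsCoverWith d e Q f) :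
    ∃ P : Fin 3 → P1 k, Function.Injective P ∧
      ∀ i, linearForm (P i).rep ^ e i ∣ bind₁ f.F (linearForm (Q i).rep) := by
  choose P hP hr _ using hf.2.2
  refine ⟨P, fun i j hij => hQ ?_, fun i => ?_⟩
  · rw [← hP i, ← hP j, hij]
  · have := hr i
    rw [Mor.ramificationIndex, hP i] at this
    exact pow_dvd_of_le_emultiplicity this.ge

theorem IsCoverWith.formDegree_eq {d : ℕ} {e : Fin 3 → ℕ} {Q : Fin 3 → P1 k} {f : Mor k}
    (hf : IsCoverWith d e Q f) : f.formDegree = d :=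
  f.degree_eq_formDegree.symm.trans hf.1

theorem Mor.totalDegree_le (f : Mor k) (j : Fin 2) : (f.F j).totalDegree ≤ f.formDegree :=
  (f.isHomogeneous j).totalDegree_le

/-- The coordinate function of a separable morphism is not a `p`-th power. -/
theorem Mor.expand_eq_zero_of_isSeparable (p : ℕ) [Fact p.Prime] [CharP k p] {f : Mor k}
    (hsep : f.IsSeparable) (hd : f.formDegree ≠ 0) {a b : Polynomial k}
    (h : dehom (f.F 0) * Polynomial.expand k p b = dehom (f.F 1) * Polynomial.expand k p a) :
    a = 0 ∧ b = 0 := by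
  have hp : p.Prime := Fact.out
  have hF1 : dehom (f.F 1) ≠ 0 := by
    intro h0
    have h1 := f.isCoprime_dehom
    have h2 := f.max_natDegree_dehom
    rw [h0, isCoprime_zero_right] at h1
    rw [h0, Polynomial.natDegree_eq_zero_of_isUnit h1] at h2
    exact hd (by simpa using h2.symm)
  by_cases hb : b = 0
  · subst hb
    rw [map_zero, mul_zero] at h
    have := (mul_eq_zero.1 h.symm).resolve_left hF1
    exact ⟨(Polynomial.expand_eq_zero hp.pos).1 this, rfl⟩
  · exfalso
    have : Algebra.IsSeparable f.pullbackField (RatFunc k) := hsep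
    refine not_le_adjoin_X_pow p f.pullbackField ?_
    rw [Mor.pullbackField, IntermediateField.adjoin_simple_le_iff, Mor.coord_eq]
    have hb' := (Polynomial.expand_ne_zero hp.pos).2 hb
    have : algebraMap (Polynomial k) (RatFunc k) (dehom (f.F 0)) /
        algebraMap (Polynomial k) (RatFunc k) (dehom (f.F 1)) =
        algebraMap (Polynomial k) (RatFunc k) (Polynomial.expand k p a) /
        algebraMap (Polynomial k) (RatFunc k) (Polynomial.expand k p b) := by
      rw [div_eq_div_iff (RatFunc.algebraMap_ne_zero hF1) (RatFunc.algebraMap_ne_zero hb'),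
        ← map_mul, ← map_mul, h, mul_comm]
    rw [this]
    exact div_mem (algebraMap_expand_mem p a) (algebraMap_expand_mem p b)

/-- The existence of a cover forces numerical admissibility. -/
theorem IsCoverWith.numericallyAdmissible (p : ℕ) [Fact p.Prime] [CharP k p] {d : ℕ}
    {e : Fin 3 → ℕ} (hd : 0 < d) (he : ∀ i, 0 < e i)
    (hde : 2 * (d : ℤ) - 2 = ∑ i, ((e i : ℤ) - 1)) {Q : Fin 3 → P1 k}
    (hQ : Function.Injective Q) {f : Mor k} (hf : IsCoverWith d e Q f) :
    NumericallyAdmissible p e := by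
  have hp : p.Prime := Fact.out
  rw [numericallyAdmissible_iff hp.pos he hde]
  intro m hm ε D hε hsum
  by_contra! hle
  obtain ⟨P, hPinj, hP⟩ := hf.exists_points hQ
  have hfd := hf.formDegree_eq
  set q := p ^ m with hq
  have hqpos : 0 < q := pow_pos hp.pos m
  -- The conditions are imposed at the Frobenius images of the `P i`, so that `expand q` brings the
  -- vanishing back to `P i`, with order multiplied by `q`. The base points `B` supply the missing
  -- `e i - q ε i`.
  obtain ⟨H, hH0, hHhom, hH⟩ := exists_pencil (d := D) (e := ε) (by omega)
    (u := fun i j => (P i).rep j ^ q) (fun i h0 => (P i).rep_nonzero (funext fun j =>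
      pow_eq_zero_iff hqpos.ne' |>.1 (congrFun h0 j))) (fun i => (Q i).rep)
  let B : MvPolynomial (Fin 2) k := ∏ i, linearForm (P i).rep ^ (e i - q * ε i)
  have hB0 : B ≠ 0 :=
    Finset.prod_ne_zero_iff.2 fun i _ => pow_ne_zero _ (linearForm_ne_zero (P i).rep_nonzero)
  have hBdeg : B.totalDegree ≤ ∑ i, (e i - q * ε i) := by
    refine IsHomogeneous.totalDegree_le (IsHomogeneous.prod _ _ _ fun i _ => ?_)
    simpa using (linearForm_isHomogeneous (P i).rep).pow (e i - q * ε i)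
  have hcross := cross_mul_eq_of_dvd (d := d) (e := e) ?_ (fun i => (P i).rep_nonzero)
    (fun i => (Q i).rep_nonzero) (fun i j hij => ?_) (F := f.F)
    (G := fun j => B * expand q (H j)) (fun j => hfd ▸ f.totalDegree_le j) (fun j => ?_) hP
    (fun i => ?_)
  · have h1 : B * (f.F 0 * expand q (H 1)) = B * (f.F 1 * expand q (H 0)) := by
      linear_combination hcross
    have h2 := congrArg dehom (mul_left_cancel₀ hB0 h1)
    -- As `m > 0`, one factor `p` can be split off: `f` agrees with a ratio of polynomials in `x ^
    -- p`, and separability then forces `H = 0`.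
    obtain ⟨m', rfl⟩ : ∃ m', m = m' + 1 := ⟨m - 1, by omega⟩
    rw [map_mul, map_mul, dehom_expand, dehom_expand, hq, pow_succ', Polynomial.expand_mul,
      Polynomial.expand_mul] at h2
    obtain ⟨h3, h4⟩ := Mor.expand_eq_zero_of_isSeparable p hf.2.1 (by omega) h2
    rw [Polynomial.expand_eq_zero (pow_pos hp.pos _)] at h3 h4
    refine hH0 (funext (Fin.forall_fin_two.2 ⟨?_, ?_⟩))
    · exact dehom_injOn (hHhom 0) (isHomogeneous_zero _ _ _) (by rw [h3]; simp)
    · exact dehom_injOn (hHhom 1) (isHomogeneous_zero _ _ _) (by rw [h4]; simp)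
  · rw [Fin.sum_univ_three] at hde ⊢
    omega
  · rw [Ne, det₂_rep_eq_zero_iff]
    exact fun h => hij (hPinj h)
  · refine (totalDegree_mul _ _).trans (le_trans (add_le_add hBdeg ?_) hle)
    rw [totalDegree_expand, mul_comm]
    exact Nat.mul_le_mul_left q (hHhom j).totalDegree_le
  · have h1 := map_dvd (expand q) (hH i)
    rw [map_pow, hq, expand_linearForm_pow, ← hq, ← pow_mul] at h1
    have h2 : bind₁ (fun j => B * expand q (H j)) (linearForm (Q i).rep) =
        B * expand q (bind₁ H (linearForm (Q i).rep)) := by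
      rw [bind₁_linearForm, bind₁_linearForm]
      simp; ring
    rw [h2]
    refine dvd_trans ?_ (mul_dvd_mul (Finset.dvd_prod_of_mem
      (fun i => linearForm (P i).rep ^ (e i - q * ε i)) (Finset.mem_univ i)) h1)
    rw [← pow_add]
    exact pow_dvd_pow _ (by omega)

end Covers

/-! ### Linear substitutions and 3-transitivity -/

section Moebius

open MvPolynomial

variable {k : Type*} [Field k]

/-- The linear substitution with columns `a` and `b`. -/
def linearSubst (a b : Fin 2 → k) (j : Fin 2) : MvPolynomial (Fin 2) k :=
  C (a j) * X 0 + C (b j) * X 1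

theorem eval_linearSubst (a b v : Fin 2 → k) :
    (fun j => eval v (linearSubst a b j)) = v 0 • a + v 1 • b := by
  funext j
  simp [linearSubst]; ring

theorem linearSubst_isHomogeneous (a b : Fin 2 → k) (j : Fin 2) :
    (linearSubst a b j).IsHomogeneous 1 :=
  ((isHomogeneous_X k 0).C_mul _).add ((isHomogeneous_X k 1).C_mul _)

theorem bind₁_linearSubst_linearForm (a b v : Fin 2 → k) :
    bind₁ (linearSubst a b) (linearForm (v 0 • a + v 1 • b)) =
      C (det₂ a b) * linearForm v := by
  rw [bind₁_linearForm]
  simp [linearSubst, linearForm, det₂]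
  ring

theorem linearForm_dvd_bind₁_linearSubst {a b u v : Fin 2 → k} {c : k} (hab : det₂ a b ≠ 0)
    (hv : v ≠ 0) (h : v 0 • a + v 1 • b = c • u) :
    linearForm v ∣ bind₁ (linearSubst a b) (linearForm u) := by
  have h1 := bind₁_linearSubst_linearForm a b v
  rw [h, linearForm_smul, map_mul, bind₁_C_right] at h1
  have hc : c ≠ 0 := by
    rintro rfl
    rw [C_0, zero_mul] at h1
    exact mul_ne_zero (C_ne_zero.2 hab) (linearForm_ne_zero hv) h1.symm
  have : linearForm v ∣ C c * bind₁ (linearSubst a b) (linearForm u) := h1 ▸ dvd_mul_left _ _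
  exact ((hc.isUnit.map C).dvd_mul_left).1 this

/-- The group of linear substitutions acts `3`-transitively on the projective line. -/
theorem exists_linear_three_points {u v : Fin 3 → Fin 2 → k}
    (hu : ∀ i j, i ≠ j → det₂ (u i) (u j) ≠ 0) (hv : ∀ i j, i ≠ j → det₂ (v i) (v j) ≠ 0) :
    ∃ a b : Fin 2 → k, det₂ a b ≠ 0 ∧ ∀ i, ∃ c : k, v i 0 • a + v i 1 • b = c • u i := by
  -- The substitution sends `v 0`, `v 1` to multiples of `u 0`, `u 1`; the weights `α`, `β` make `v
  -- 2` go to a multiple of `u 2`, through `det₂ (u 1) (u 2) • u 0 + det₂ (u 2) (u 0) • u 1 = -det₂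
  -- (u 0) (u 1) • u 2`.
  let α := det₂ (u 1) (u 2) * det₂ (v 0) (v 2)
  let β := det₂ (u 2) (u 0) * det₂ (v 2) (v 1)
  refine ⟨fun j => α * v 1 1 * u 0 j - β * v 0 1 * u 1 j,
    fun j => β * v 0 0 * u 1 j - α * v 1 0 * u 0 j, ?_, ?_⟩
  · have : det₂ (fun j => α * v 1 1 * u 0 j - β * v 0 1 * u 1 j)
        (fun j => β * v 0 0 * u 1 j - α * v 1 0 * u 0 j) =
        α * β * det₂ (v 0) (v 1) * det₂ (u 0) (u 1) := by
      simp only [det₂]; ring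
    rw [this]
    have h1 := hu 0 1 (by decide); have h2 := hu 1 2 (by decide); have h3 := hu 2 0 (by decide)
    have h4 := hv 0 1 (by decide); have h5 := hv 0 2 (by decide); have h6 := hv 2 1 (by decide)
    exact mul_ne_zero (mul_ne_zero (mul_ne_zero (mul_ne_zero h2 h5) (mul_ne_zero h3 h6)) h4) h1
  · intro i
    refine ⟨![α * det₂ (v 0) (v 1), β * det₂ (v 0) (v 1),
      -(det₂ (v 0) (v 2) * det₂ (v 2) (v 1) * det₂ (u 0) (u 1))] i, funext fun j => ?_⟩
    fin_cases i <;> fin_cases j <;> simp [α, β, det₂] <;> ring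

variable [IsAlgClosed k]

/-- The morphism defined by an invertible linear substitution. -/
def Mor.ofLinear (a b : Fin 2 → k) (hab : det₂ a b ≠ 0) : Mor k where
  formDegree := 1
  F := linearSubst a b
  isHomogeneous := linearSubst_isHomogeneous a b
  no_common_zero v hv h := by
    rw [eval_linearSubst] at h
    have h0 := congrFun h 0
    have h1 := congrFun h 1
    simp only [Pi.add_apply, Pi.smul_apply, smul_eq_mul, Pi.zero_apply] at h0 h1
    have e0 : v 0 * det₂ a b = 0 := by
      simp only [det₂]; linear_combination b 1 * h0 - b 0 * h1
    have e1 : v 1 * det₂ a b = 0 := by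
      simp only [det₂]; linear_combination a 0 * h1 - a 1 * h0
    rcases (vec_ne_zero_iff v).1 hv with h | h
    · exact hab ((mul_eq_zero.1 e0).resolve_left h)
    · exact hab ((mul_eq_zero.1 e1).resolve_left h)

theorem Mor.map_ofLinear_map_ofLinear {a b a' b' : Fin 2 → k} (hab : det₂ a b ≠ 0)
    (hab' : det₂ a' b' ≠ 0) {c : k}
    (h : ∀ v : Fin 2 → k, (v 0 • a + v 1 • b) 0 • a' + (v 0 • a + v 1 • b) 1 • b' = c • v)
    (P : P1 k) : (Mor.ofLinear a' b' hab').map ((Mor.ofLinear a b hab).map P) = P := by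
  rw [show (Mor.ofLinear a b hab).map P = Projectivization.mk k _
    ((Mor.ofLinear a b hab).no_common_zero P.rep P.rep_nonzero) from rfl, Mor.map_mk,
    mk_eq_iff_det₂_rep]
  have : (fun j => eval (fun j => eval P.rep ((Mor.ofLinear a b hab).F j))
      ((Mor.ofLinear a' b' hab').F j)) = c • P.rep := by
    change (fun j => eval (fun j => eval P.rep (linearSubst a b j)) (linearSubst a' b' j)) = _
    rw [eval_linearSubst a b P.rep, eval_linearSubst a' b', h]
  rw [this]
  simp [det₂]; ring

theorem Mor.isAutomorphism_ofLinear {a b : Fin 2 → k} (hab : det₂ a b ≠ 0) :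
    (Mor.ofLinear a b hab).IsAutomorphism := by
  -- The inverse is given by the adjugate matrix; both composites are multiplication by `det₂ a b`.
  have hab' : det₂ ![b 1, -a 1] ![-b 0, a 0] ≠ 0 := by
    convert hab using 1
    simp [det₂]; ring
  refine ⟨Mor.ofLinear ![b 1, -a 1] ![-b 0, a 0] hab',
    Mor.map_ofLinear_map_ofLinear hab hab' (c := det₂ a b) fun v => ?_,
    Mor.map_ofLinear_map_ofLinear hab' hab (c := det₂ a b) fun v => ?_⟩ <;>
  · funext j
    fin_cases j <;> simp [det₂] <;> ring

end Moebius

/-! ### Uniqueness and existence of covers -/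

section Covers

open MvPolynomial

variable {k : Type*} [Field k] [IsAlgClosed k]

/-- Covers with the same data differ by an automorphism of the source. -/
theorem IsCoverWith.exists_automorphism {d : ℕ} {e : Fin 3 → ℕ} (hde : ∑ i, e i = 2 * d + 1)
    {Q : Fin 3 → P1 k} (hQ : Function.Injective Q) {f f' : Mor k} (hf : IsCoverWith d e Q f)
    (hf' : IsCoverWith d e Q f') :
    ∃ φ : Mor k, φ.IsAutomorphism ∧ ∀ P, f'.map P = f.map (φ.map P) := by
  obtain ⟨P, hPinj, hP⟩ := hf.exists_points hQ
  obtain ⟨P', hPinj', hP'⟩ := hf'.exists_points hQ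
  have hdet {P : Fin 3 → P1 k} (h : Function.Injective P) (i j : Fin 3) (hij : i ≠ j) :
      det₂ (P i).rep (P j).rep ≠ 0 := by
    rw [Ne, det₂_rep_eq_zero_iff]
    exact fun h' => hij (h h')
  obtain ⟨a, b, hab, hc⟩ := exists_linear_three_points (hdet hPinj) (hdet hPinj')
  choose c hc using hc
  refine ⟨Mor.ofLinear a b hab, Mor.isAutomorphism_ofLinear hab, fun R => ?_⟩
  -- After the substitution carrying `P' i` to `P i`, the pencil of `f` has the same vanishing as
  -- that of `f'`, and rigidity applies.
  have hcross := cross_mul_eq_of_dvd (d := d) (e := e) (by omega) (fun i => (P' i).rep_nonzero)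
    (fun i => (Q i).rep_nonzero) (hdet hPinj') (F := fun j => bind₁ (linearSubst a b) (f.F j))
    (G := f'.F) (fun j => ?_) (fun j => hf'.formDegree_eq ▸ f'.totalDegree_le j)
    (fun i => ?_) hP'
  · have h1 := congrArg (eval R.rep) hcross
    rw [map_mul, map_mul] at h1
    have heval (Φ : MvPolynomial (Fin 2) k) : eval R.rep (bind₁ (linearSubst a b) Φ) =
        eval (fun j => eval R.rep (linearSubst a b j)) Φ := by
      induction Φ using MvPolynomial.induction_on with
      | C a => simp
      | add p q hp hq => simp [hp, hq]
      | mul_X p i hp => simp [hp]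
    simp only [heval] at h1
    rw [show (Mor.ofLinear a b hab).map R = Projectivization.mk k _
      ((Mor.ofLinear a b hab).no_common_zero R.rep R.rep_nonzero) from rfl, Mor.map_mk, Mor.map,
      mk_eq_mk_iff_det₂]
    change eval _ (f'.F 0) * eval (fun j => eval R.rep (linearSubst a b j)) (f.F 1) -
      eval _ (f'.F 1) * eval (fun j => eval R.rep (linearSubst a b j)) (f.F 0) = 0
    linear_combination -h1
  · have := (f.isHomogeneous j).aeval (linearSubst a b) (linearSubst_isHomogeneous a b)
    rw [hf.formDegree_eq, one_mul] at this
    exact this.totalDegree_le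
  · have h1 := map_dvd (bind₁ (linearSubst a b)) (hP i)
    rw [map_pow] at h1
    have h2 : bind₁ (fun j => bind₁ (linearSubst a b) (f.F j)) (linearForm (Q i).rep) =
        bind₁ (linearSubst a b) (bind₁ f.F (linearForm (Q i).rep)) := by
      rw [bind₁_linearForm, bind₁_linearForm]; simp
    rw [h2]
    exact (pow_dvd_pow_of_dvd
      (linearForm_dvd_bind₁_linearSubst hab (P' i).rep_nonzero (hc i)) _).trans h1

/-- Numerical admissibility suffices for the existence of a cover. -/
theorem exists_isCoverWith (p : ℕ) [Fact p.Prime] [CharP k p] {d : ℕ} {e : Fin 3 → ℕ}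
    (he : ∀ i, 0 < e i) (hde : 2 * (d : ℤ) - 2 = ∑ i, ((e i : ℤ) - 1)) (hle : ∀ i, e i ≤ d)
    {Q : Fin 3 → P1 k} (hQ : Function.Injective Q) (hadm : NumericallyAdmissible p e) :
    ∃ f : Mor k, IsCoverWith d e Q f := by
  have hp : p.Prime := Fact.out
  have hsum : ∑ i, e i = 2 * d + 1 := by
    rw [Fin.sum_univ_three] at hde ⊢
    omega
  have hsum' : ∑ i, (e i - 1) + 2 = 2 * d := by
    have := he 0; have := he 1; have := he 2
    rw [Fin.sum_univ_three] at hsum ⊢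
    omega
  have : Infinite k := IsAlgClosed.instInfinite
  obtain ⟨t, ht⟩ : ∃ t : Fin 3 → k, Function.Injective t :=
    ⟨fun i => Infinite.natEmbedding k i, (Infinite.natEmbedding k).injective.comp Fin.val_injective⟩
  have hu (i) : (![t i, 1] : Fin 2 → k) ≠ 0 := by simp
  obtain ⟨F, hF0, hFhom, hF⟩ := exists_pencil (d := d) (e := e) (by omega) hu fun i => (Q i).rep
  have hdvd (i) : (Polynomial.X - Polynomial.C (t i)) ^ e i ∣ Polynomial.C ((Q i).rep 1) *
      dehom (F 0) - Polynomial.C ((Q i).rep 0) * dehom (F 1) := by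
    have := X_sub_C_pow_dvd_dehom (by simp) (hF i)
    simpa [dehom_bind₁_linearForm] using this
  have hdeh : dehom (F 0) ≠ 0 ∨ dehom (F 1) ≠ 0 := by
    by_contra! h
    refine hF0 (funext (Fin.forall_fin_two.2 ⟨?_, ?_⟩))
    · exact dehom_injOn (hFhom 0) (isHomogeneous_zero _ _ _) (by rw [h.1]; simp)
    · exact dehom_injOn (hFhom 1) (isHomogeneous_zero _ _ _) (by rw [h.2]; simp)
  obtain ⟨hcop, hW, hmax⟩ := isCoprime_and_wronskian_ne_zero p hsum hle
    ((numericallyAdmissible_iff hp.pos he hde).1 hadm) ht (fun i => (Q i).rep_nonzero)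
    (fun i j hij => by
      rw [Ne, det₂_rep_eq_zero_iff]
      exact fun h => hij (hQ h)) hdeh (natDegree_dehom_le (hFhom 0)) (natDegree_dehom_le (hFhom 1))
      hdvd
  have hWdeg := natDegree_wronskian_add_two_le (natDegree_dehom_le (hFhom 0))
    (natDegree_dehom_le (hFhom 1)) hW
  let f : Mor k := Mor.ofCoprime F hFhom hcop hmax
  have hmap (i) : f.map (Projectivization.mk k _ (hu i)) = Q i := by
    rw [Mor.map_mk, mk_eq_iff_det₂_rep, ← eval_bind₁_linearForm]
    obtain ⟨Ψ, hΨ⟩ := (dvd_pow_self _ (he i).ne').trans (hF i)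
    change eval _ (bind₁ F _) = 0
    rw [hΨ, map_mul, eval_linearForm]
    simp [det₂]
  refine ⟨f, f.degree_eq_formDegree, ?_, fun i => ⟨_, hmap i, ?_, fun P hP hne => ?_⟩⟩
  · rw [Mor.IsSeparable, Mor.pullbackField, Mor.coord_eq]
    exact isSeparable_adjoin_div hW
  · rw [Mor.ramificationIndex, hmap, linForm_eq, linForm_eq,
      emultiplicity_eq_of_associated_left (associated_linearForm_rep_mk (hu i)).symm,
      emultiplicity_eq_coe]
    refine ⟨hF i, fun h => ?_⟩
    have h1 := X_sub_C_pow_dvd_dehom (by simp) h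
    change _ ∣ dehom (bind₁ F _) at h1
    rw [dehom_bind₁_linearForm] at h1
    -- The indices `e j` already exhaust the bound `2d - 2` on the degree of the Wronskian, so none
    -- can be larger.
    have h2 := sum_sub_one_le_natDegree_wronskian ht (r := Function.update e i (e i + 1))
      (fun i => (Q i).rep_nonzero) hW fun j => by
        by_cases hj : j = i
        · subst hj; simpa using h1
        · rw [Function.update_of_ne hj]; exact hdvd j
    have h3 : ∑ j, (e j - 1) < ∑ j, (Function.update e i (e i + 1) j - 1) := by
      refine Finset.sum_lt_sum (fun j _ => ?_) ⟨i, Finset.mem_univ i, ?_⟩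
      · by_cases hj : j = i
        · subst hj; simp
        · rw [Function.update_of_ne hj]
      · have := he i
        simp only [Function.update_self]
        omega
    omega
  · have hroot := (f.map_eq_iff P (Q i)).1 hP
    have hhom := isHomogeneous_bind₁_linearForm hFhom (Q i).rep
    rw [Mor.ramificationIndex, hP, linForm_eq, linForm_eq,
      show (1 : ℕ∞) = (1 : ℕ) from rfl, emultiplicity_eq_coe]
    refine ⟨?_, fun h => ?_⟩
    · rw [pow_one]
      exact linearForm_dvd_of_eval_eq_zero hhom P.rep_nonzero hroot
    change _ ∣ bind₁ F _ at h
    by_cases hP1 : P.rep 1 = 0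
    · have hne0 : bind₁ F (linearForm (Q i).rep) ≠ 0 := by
        intro h0
        have := combination_ne_zero (Q i).rep_nonzero hW
        rw [← dehom_bind₁_linearForm, h0, map_zero] at this
        exact this rfl
      -- Ramification at infinity would make the fibre equation of degree at most `d - 2`, and the
      -- Wronskian of degree below `2d - 2`.
      have h1 := natDegree_dehom_add_le P.rep_nonzero hP1 hhom hne0 h
      rw [dehom_bind₁_linearForm] at h1
      have h2 := natDegree_wronskian_lt_of_combination (Q i).rep_nonzero
        (natDegree_dehom_le (hFhom 0)) (natDegree_dehom_le (hFhom 1)) hW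
      have h3 := sum_sub_one_le_natDegree_wronskian ht (fun i => (Q i).rep_nonzero) hW hdvd
      omega
    · have h1 := X_sub_C_pow_dvd_dehom hP1 h
      rw [dehom_bind₁_linearForm] at h1
      have hPt (j) : P.rep 0 / P.rep 1 ≠ t j := by
        intro hj
        have hPj : P = Projectivization.mk k _ (hu j) := by
          rw [eq_comm, mk_eq_iff_det₂_rep]
          simp [det₂, ← hj, hP1]
        have : i = j := hQ (by rw [← hP, hPj, hmap])
        subst this
        exact hne hPj
      -- The point `P` enters as a fourth point `none`, of index `2` over the same `Q i`, and
      -- exceeds the bound by one.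
      have h2 := sum_sub_one_le_natDegree_wronskian (ι := Option (Fin 3))
        (t := fun o => o.elim (P.rep 0 / P.rep 1) t) (r := fun o => o.elim 2 e)
        (w := fun o => (Q (o.getD i)).rep) ?_ (fun o => (Q _).rep_nonzero) hW ?_
      · rw [Fintype.sum_option] at h2
        simp only [Option.elim] at h2
        omega
      · rintro (_ | j) (_ | l) h
        · rfl
        · exact absurd h (hPt l)
        · exact absurd h.symm (hPt j)
        · exact congrArg some (ht h)
      · rintro (_ | j)
        · exact h1
        · exact hdvd j

end Covers

end ThreePointCover

end

theorem mainTheorem2 {k : Type*} [Field k] [IsAlgClosed k] (p : ℕ) [Fact p.Prime] [CharP k p]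
    (d : ℕ) (e : Fin 3 → ℕ) (hd : 0 < d) (he : ∀ i, 0 < e i)
    (hde : 2 * (d : ℤ) - 2 = ∑ i, ((e i : ℤ) - 1))
    (hcop : ∀ i, (e i).Coprime p) (hle : ∀ i, e i ≤ d)
    (Q : Fin 3 → ThreePointCover.P1 k) (hQ : Function.Injective Q) :
    (ThreePointCover.NumericallyAdmissible p e ↔
      ∃ f : ThreePointCover.Mor k, ThreePointCover.IsCoverWith d e Q f) ∧
    (∀ f f' : ThreePointCover.Mor k,
      ThreePointCover.IsCoverWith d e Q f → ThreePointCover.IsCoverWith d e Q f' →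
      ∃ φ : ThreePointCover.Mor k, φ.IsAutomorphism ∧ ∀ P, f'.map P = f.map (φ.map P)) := by
  refine ⟨⟨ThreePointCover.exists_isCoverWith p he hde hle hQ, fun ⟨f, hf⟩ =>
    hf.numericallyAdmissible p hd he hde hQ⟩, fun f f' hf hf' => hf.exists_automorphism ?_ hQ hf'⟩
  rw [Fin.sum_univ_three] at hde ⊢
  omega
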